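/- Let $\mathcal J$ be the space of (whole-line, bounded) Jacobi matrices $$(Ju)_n=a_nu_{n+1}+a_{n-1}u_{n-1}+b_nu_n ,\qquad n\in\mathbb Z,$$ with bounded real sequences $a_n>0$, $b_n$, regarded as bounded self-adjoint operators on $\ell^2(\mathbb Z)$; $\|\cdot\|$ denotes the operator norm. For a bounded symmetric tridiagonal operator $T$ put $\|T\|_\infty=\max\{\sup_n|T_{n,n+1}|,\ \sup_n|T_{n,n}|\}$, where $T_{jk}=\langle\delta_j,T\delta_k\rangle$. Let $f\in C^2(\mathbb R)$ be real-valued. For $J\in\mathcal J$ let $f(J)_a$ be the infinite matrix with $(f(J)_a)_{jk}=f(J)_{jk}$ for $j<k$, $=-f(J)_{jk}$ for $j>k$, and $=0$ for $j=k$, and let $X_f(J)$ be the bounded tridiagonal operator on $\ell^2(\mathbb Z)$ with matrix elements $X_f(J)_{jk}=(f(J)_aJ-Jf(J)_a)_{jk}$ for $|j-k|\le 1$ (products of infinite matrices, row times column) and $X_f(J)_{jk}=0$ for $|j-k|>1$. For every $J\in\mathcal J$ the Lax equation $\dot J(t)=X_f(J(t))$, $J(0)=J$ (derivative in operator norm)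 has a unique global solution $J:\mathbb R\to\mathcal J$, and $f\cdot J$ denotes $J(1)$. Theorem. The map $\mathcal J\to\mathcal J$, $J\mapsto f\cdot J$, is continuous with respect to the operator norm. In fact, for every $R$ there is a constant $L\ge 0$ (depending only on $f$ and $R$) such that $$\|X_f(J)-X_f(J')\|_\infty\le L\,\|J-J'\|_\infty\qquad\text{for all } J,J'\in\mathcal J \text{ with } \|J\|,\|J'\|\le R, \tag{1}$$ and, whenever $L_f$ is a constant $L$ for which (1) holds, $$\|f\cdot J-f\cdot J'\|_\infty\le e^{L_f}\,\|J-J'\|_\infty\qquad\text{for all } J,J'\in\mathcal J \text{ with } \|J\|,\|J'\|\le R .$$ -/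

import Mathlib

noncomputable section

namespace Toda

/-- The Hilbert space `ℓ²(ℤ)`, with complex scalars. -/
abbrev Hil : Type := lp (fun _ : ℤ => ℂ) 2

/-- The standard unit vectors of `ℓ²(ℤ)`. -/
def delta (n : ℤ) : Hil := lp.single 2 n (1 : ℂ)

/-- The matrix element `⟨δ_j, T δ_k⟩` of a bounded operator. -/
def entry (T : Hil →L[ℂ] Hil) (j k : ℤ) : ℂ := inner ℂ (delta j) (T (delta k))

theorem inner_delta (j : ℤ) (v : Hil) : inner ℂ (delta j) v = v j := by
  simp [delta, lp.inner_single_left]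

theorem delta_apply (k n : ℤ) : (delta k : ℤ → ℂ) n = if n = k then 1 else 0 := by
  unfold delta
  by_cases h : n = k
  · subst h
    simp
  · simp [h, lp.single_apply]

theorem norm_delta (k : ℤ) : ‖delta k‖ = 1 := by
  have := lp.norm_single (E := fun _ : ℤ => ℂ) (p := 2) (by norm_num) k (1 : ℂ)
  simpa [delta] using this

theorem norm_entry_le (T : Hil →L[ℂ] Hil) (j k : ℤ) : ‖entry T j k‖ ≤ ‖T‖ := by
  calc ‖entry T j k‖ ≤ ‖delta j‖ * ‖T (delta k)‖ := norm_inner_le_norm _ _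
    _ ≤ ‖delta j‖ * (‖T‖ * ‖delta k‖) := by gcongr; exact T.le_opNorm _
    _ = ‖T‖ := by simp [norm_delta]

theorem sq_summable (u : Hil) : Summable fun n => ‖u n‖ ^ 2 := by
  have := (lp.memℓp u).summable (by norm_num)
  simpa using this

theorem sq_norm (u : Hil) : ‖u‖ ^ 2 = ∑' n, ‖u n‖ ^ 2 := by
  have := lp.norm_rpow_eq_tsum (p := 2) (by norm_num) u
  simpa using this

theorem summable_weighted (c : ℤ → ℂ) (C : ℝ) (hC : ∀ n, ‖c n‖ ≤ C) (m : ℤ) (u : Hil) :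
    Summable (fun n => ‖c n * u (n + m)‖ ^ 2) ∧
      ∑' n, ‖c n * u (n + m)‖ ^ 2 ≤ C ^ 2 * ‖u‖ ^ 2 := by
  have h1 : Summable fun n => ‖u (n + m)‖ ^ 2 :=
    (Equiv.addRight m).summable_iff.2 (sq_summable u)
  have h2 : ∑' n, ‖u (n + m)‖ ^ 2 = ‖u‖ ^ 2 := by
    rw [sq_norm]
    exact (Equiv.addRight m).tsum_eq (fun n => ‖u n‖ ^ 2)
  have h3 : ∀ n, ‖c n * u (n + m)‖ ^ 2 ≤ C ^ 2 * ‖u (n + m)‖ ^ 2 := by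
    intro n
    rw [norm_mul, mul_pow]
    gcongr
    exact hC n
  have h4 : Summable fun n => ‖c n * u (n + m)‖ ^ 2 :=
    Summable.of_nonneg_of_le (fun _ => by positivity) h3 (h1.mul_left _)
  refine ⟨h4, ?_⟩
  rw [← h2, ← tsum_mul_left]
  exact h4.tsum_le_tsum h3 (h1.mul_left _)

/-- For a bounded sequence `c` and `m : ℤ`, the bounded operator `(T u)_n = c_n u_{n+m}`. -/
def weightedShift (c : ℤ → ℂ) (hc : ∃ C : ℝ, ∀ n, ‖c n‖ ≤ C) (m : ℤ) : Hil →L[ℂ] Hil :=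
  LinearMap.mkContinuousOfExistsBound
    { toFun := fun u => ⟨fun n => c n * u (n + m), by
        obtain ⟨C, hC⟩ := hc
        apply memℓp_gen
        simpa using (summable_weighted c C hC m u).1⟩
      map_add' := fun u v => by
        ext n
        exact mul_add _ _ _
      map_smul' := fun r u => by
        ext n
        simp [mul_left_comm] }
    (by
      obtain ⟨C, hC⟩ := hc
      refine ⟨C, fun u => ?_⟩
      have hC0 : 0 ≤ C := (norm_nonneg _).trans (hC 0)
      refine abs_le_of_sq_le_sq' ?_ (by positivity) |>.2
      rw [sq_norm, mul_pow]
      exact (summable_weighted c C hC m u).2)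

@[simp]
theorem weightedShift_apply (c : ℤ → ℂ) (hc : ∃ C : ℝ, ∀ n, ‖c n‖ ≤ C) (m : ℤ) (u : Hil) (n : ℤ) :
    weightedShift c hc m u n = c n * u (n + m) := rfl

/-- A Jacobi matrix, given by its coefficients: bounded real sequences `a`, `b` with `a > 0`. -/
@[ext]
structure Jacobi where
  a : ℤ → ℝ
  b : ℤ → ℝ
  a_pos : ∀ n, 0 < a n
  a_bdd : ∃ C : ℝ, ∀ n, |a n| ≤ C
  b_bdd : ∃ C : ℝ, ∀ n, |b n| ≤ C

/-- The bounded operator on `ℓ²(ℤ)` of a Jacobi matrix: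
`(J u)_n = a_n u_{n+1} + a_{n-1} u_{n-1} + b_n u_n`. -/
def Jacobi.op (J : Jacobi) : Hil →L[ℂ] Hil :=
  weightedShift (fun n => (J.a n : ℂ)) (by simpa using J.a_bdd) 1
    + weightedShift (fun n => (J.a (n - 1) : ℂ))
        (by obtain ⟨C, hC⟩ := J.a_bdd; exact ⟨C, fun n => by simpa using hC (n - 1)⟩) (-1)
    + weightedShift (fun n => (J.b n : ℂ)) (by simpa using J.b_bdd) 0

theorem Jacobi.op_apply (J : Jacobi) (u : Hil) (n : ℤ) :
    J.op u n = J.a n * u (n + 1) + J.a (n - 1) * u (n - 1) + J.b n * u n := by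
  simp [Jacobi.op, sub_eq_add_neg]

theorem Jacobi.entry_op (J : Jacobi) (j k : ℤ) :
    entry J.op j k = if k = j + 1 then (J.a j : ℂ) else if j = k + 1 then (J.a k : ℂ)
      else if j = k then (J.b j : ℂ) else 0 := by
  rw [entry, inner_delta, J.op_apply]
  simp only [delta_apply]
  split_ifs <;> first | omega | (subst_vars; simp)

theorem clm_ext_entry {S T : Hil →L[ℂ] Hil} (h : ∀ j k, entry S j k = entry T j k) : S = T := by
  have hd : ∀ k, S (delta k) = T (delta k) := by
    intro k
    ext j
    have := h j k
    rwa [entry, entry, inner_delta, inner_delta] at this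
  ext1 u
  have hu := lp.hasSum_single (E := fun _ : ℤ => ℂ) (p := 2) (by norm_num) u
  have e : ∀ k, lp.single (E := fun _ : ℤ => ℂ) 2 k (u k) = u k • delta k := by
    intro k
    rw [delta, ← lp.single_smul]
    simp
  simp only [e] at hu
  have hS := hu.mapL S
  have hT := hu.mapL T
  simp only [map_smul, hd] at hS hT
  exact hS.unique hT

/-- Jacobi matrices are self-adjoint, so that `funCalc` is their functional calculus. -/
theorem Jacobi.isSelfAdjoint_op (J : Jacobi) : IsSelfAdjoint J.op := by
  rw [ContinuousLinearMap.isSelfAdjoint_iff']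
  apply clm_ext_entry
  intro j k
  have h1 : entry (ContinuousLinearMap.adjoint J.op) j k = star (entry J.op k j) := by
    rw [entry, entry, ContinuousLinearMap.adjoint_inner_right]
    exact (inner_conj_symm _ _).symm
  rw [h1, J.entry_op, J.entry_op]
  split_ifs <;> first | omega | (subst_vars; simp)

/-- The space of Jacobi matrices carries the topology of the operator norm. -/
instance : TopologicalSpace Jacobi := TopologicalSpace.induced Jacobi.op inferInstance

/-- `‖T‖_∞ = max (‖a‖_∞, ‖b‖_∞)` for a symmetric tridiagonal operator `T` with off-diagonal
coefficients `a_n = T_{n,n+1}` and diagonal coefficients `b_n = T_{n,n}`. -/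
def supNorm (T : Hil →L[ℂ] Hil) : ℝ :=
  max (⨆ n : ℤ, ‖entry T n (n + 1)‖) (⨆ n : ℤ, ‖entry T n n‖)

/-- The functional calculus `f(T)` of a bounded self-adjoint operator on a Hilbert space. -/
def funCalc {H : Type*} [NormedAddCommGroup H] [InnerProductSpace ℂ H] [CompleteSpace H]
    (f : ℝ → ℝ) (T : H →L[ℂ] H) : H →L[ℂ] H := cfc f T

/-- The anti-symmetric part `A_a` of an infinite matrix `A`. -/
def antisymPart (A : ℤ → ℤ → ℂ) (j k : ℤ) : ℂ :=
  if j < k then A j k else if k < j then -A j k else 0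

/-- The row-times-column product of infinite matrices. It is used only when one factor is
tridiagonal, so that the sum has at most three nonzero terms. -/
def matMul (A B : ℤ → ℤ → ℂ) (j k : ℤ) : ℂ := ∑' l : ℤ, A j l * B l k

/-- The matrix elements of `X_f(J)`: those of `[f(J)_a, J]` on the three central diagonals, and `0`
elsewhere. -/
def laxEntry (f : ℝ → ℝ) (J : Jacobi) (j k : ℤ) : ℂ :=
  if |j - k| ≤ 1 then
    matMul (antisymPart (entry (funCalc f J.op))) (entry J.op) j k
      - matMul (entry J.op) (antisymPart (entry (funCalc f J.op))) j k
  else 0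

theorem norm_antisymPart_le (T : Hil →L[ℂ] Hil) (j k : ℤ) :
    ‖antisymPart (entry T) j k‖ ≤ ‖T‖ := by
  unfold antisymPart
  split_ifs
  · exact norm_entry_le T j k
  · simpa using norm_entry_le T j k
  · simp

theorem Jacobi.entry_op_eq_zero (J : Jacobi) {j k : ℤ} (h : 1 < |j - k|) : entry J.op j k = 0 := by
  rw [J.entry_op]
  rw [lt_abs] at h
  split_ifs <;> first | omega | rfl

theorem norm_matMul_right_le (A : ℤ → ℤ → ℂ) (C : ℝ) (hA : ∀ j k, ‖A j k‖ ≤ C) (J : Jacobi)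
    (j k : ℤ) : ‖matMul A (entry J.op) j k‖ ≤ 3 * (C * ‖J.op‖) := by
  have hs : matMul A (entry J.op) j k
      = ∑ l ∈ Finset.Icc (k - 1) (k + 1), A j l * entry J.op l k := by
    apply tsum_eq_sum
    intro l hl
    rw [J.entry_op_eq_zero, mul_zero]
    rw [Finset.mem_Icc] at hl
    rw [lt_abs]
    omega
  have hb : ∀ l ∈ Finset.Icc (k - 1) (k + 1), ‖A j l * entry J.op l k‖ ≤ C * ‖J.op‖ := by
    intro l _
    rw [norm_mul]
    exact mul_le_mul (hA j l) (norm_entry_le _ _ _) (norm_nonneg _)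
      ((norm_nonneg _).trans (hA j l))
  have hc : (Finset.Icc (k - 1) (k + 1)).card = 3 := by
    rw [Int.card_Icc]
    omega
  rw [hs]
  refine (norm_sum_le_of_le _ hb).trans ?_
  simp [hc]

theorem norm_matMul_left_le (A : ℤ → ℤ → ℂ) (C : ℝ) (hA : ∀ j k, ‖A j k‖ ≤ C) (J : Jacobi)
    (j k : ℤ) : ‖matMul (entry J.op) A j k‖ ≤ 3 * (C * ‖J.op‖) := by
  have e : matMul (entry J.op) A j k = matMul (fun x y => A y x) (entry J.op) k j := by
    unfold matMul
    refine tsum_congr fun l => ?_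
    have : entry J.op j l = entry J.op l j := by
      rw [J.entry_op, J.entry_op]
      split_ifs <;> first | omega | (subst_vars; rfl)
    rw [this, mul_comm]
  rw [e]
  exact norm_matMul_right_le _ C (fun x y => hA y x) J k j

theorem laxEntry_bdd (f : ℝ → ℝ) (J : Jacobi) : ∃ C : ℝ, ∀ j k, ‖laxEntry f J j k‖ ≤ C := by
  refine ⟨3 * (‖funCalc f J.op‖ * ‖J.op‖) + 3 * (‖funCalc f J.op‖ * ‖J.op‖), fun j k => ?_⟩
  unfold laxEntry
  split_ifs
  · exact (norm_sub_le _ _).trans (add_le_add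
      (norm_matMul_right_le _ _ (norm_antisymPart_le _) J j k)
      (norm_matMul_left_le _ _ (norm_antisymPart_le _) J j k))
  · rw [norm_zero]
    positivity

/-- The bounded tridiagonal operator `X_f(J)` on `ℓ²(ℤ)`, with matrix elements `laxEntry f J`. -/
def laxField (f : ℝ → ℝ) (J : Jacobi) : Hil →L[ℂ] Hil :=
  weightedShift (fun n => laxEntry f J n (n + 1))
      (by obtain ⟨C, hC⟩ := laxEntry_bdd f J; exact ⟨C, fun n => hC _ _⟩) 1
    + weightedShift (fun n => laxEntry f J n (n - 1))
      (by obtain ⟨C, hC⟩ := laxEntry_bdd f J; exact ⟨C, fun n => hC _ _⟩) (-1)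
    + weightedShift (fun n => laxEntry f J n n)
      (by obtain ⟨C, hC⟩ := laxEntry_bdd f J; exact ⟨C, fun n => hC _ _⟩) 0

theorem entry_laxField (f : ℝ → ℝ) (J : Jacobi) (j k : ℤ) :
    entry (laxField f J) j k = laxEntry f J j k := by
  have h0 : ¬ |j - k| ≤ 1 → laxEntry f J j k = 0 := fun h => by simp [laxEntry, h]
  rw [entry, inner_delta, laxField]
  simp only [add_apply, lp.coeFn_add, Pi.add_apply, weightedShift_apply,
    delta_apply]
  by_cases h : |j - k| ≤ 1
  · rw [abs_le] at h
    have : k = j + 1 ∨ k = j - 1 ∨ k = j := by omega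
    rcases this with rfl | rfl | rfl
    · have h1 : ¬ j + -1 = j + 1 := by omega
      simp [h1]
    · have h1 : ¬ j + 1 = j - 1 := by omega
      have h2 : j + -1 = j - 1 := by omega
      have h3 : ¬ j = j - 1 := by omega
      simp [h1, h2, h3]
    · simp
  · rw [h0 h]
    rw [abs_le] at h
    have h4 : ¬ j = k := by omega
    have h1 : ¬ j + 1 = k := by omega
    have h2 : ¬ j + -1 = k := by omega
    simp [h1, h2, h4]

/-- `γ` is a global solution of the Lax equation `dJ/dt = X_f(J)`, `J(0) = J`, in the space of
Jacobi matrices; the derivative is taken with respect to the operator norm. -/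
def IsLaxSolution (f : ℝ → ℝ) (J : Jacobi) (γ : ℝ → Jacobi) : Prop :=
  γ 0 = J ∧ ∀ t : ℝ, HasDerivAt (fun s => (γ s).op) (laxField f (γ t)) t

open Classical in
/-- `f · J = J(1)`, where `J(t)` is the global solution of the Lax equation with `J(0) = J`
(and, by convention, `J` if there is no global solution). -/
def act (f : ℝ → ℝ) (J : Jacobi) : Jacobi :=
  if h : ∃ γ, IsLaxSolution f J γ then h.choose 1 else J

/-- `L` is a Lipschitz constant, with respect to `‖·‖_∞`, for `X_f` on the set of Jacobi matrices
of operator norm at most `R`. -/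
def IsLaxLipschitzConst (f : ℝ → ℝ) (R L : ℝ) : Prop :=
  ∀ J J' : Jacobi, ‖J.op‖ ≤ R → ‖J'.op‖ ≤ R →
    supNorm (laxField f J - laxField f J') ≤ L * supNorm (J.op - J'.op)

end Toda

end

/-! The Lax equation is treated as an ordinary differential equation for the coefficients (a, b) in
the Banach space `Coeff` with the supremum norm, which on tridiagonal operators is equivalent to the
operator norm. Since S = f(J) is real, symmetric and commutes with J, the commutator [S_a, J] is
tridiagonal and involves only the entries of S on the central diagonals (`antisymPart_commutator`).
Thus the vector field is `lax (f(J)) J`, with `lax` bounded and bilinear, and no bound on the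
triangular truncation S ↦ S_a is needed.

Lipschitz estimate: after a cut-off, a C² function has a Fourier series with ∑ |n cₙ| < ∞, and A ↦
exp(isA) is |s|-Lipschitz on self-adjoint elements; hence f is operator Lipschitz on bounded sets
(`exists_norm_cfc_sub_le`). Bilinearity of `lax` gives (1).

A priori bound: for a polynomial p the matrix p(J)_a is banded, so it is a bounded skew-adjoint
operator B, and perturbing J by h[B, J] raises ‖J‖ only by O(h²). Approximating f by polynomials,
the operator norm does not grow along the flow, and time reversal amounts to replacing f by -f
(`norm_op_le_of_hasDerivAt`).

The a priori bound confines solutions to a set where the field is Lipschitz. This gives global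
existence and uniqueness, and Grönwall's inequality on [0, 1] gives the factor exp L. -/

noncomputable section

open Set Filter Topology MeasureTheory
open scoped Real BoundedContinuousFunction NNReal

/-! ### Operator Lipschitz bounds from trigonometric series. -/

section Exponential

variable {A : Type*} [CStarAlgebra A]

theorem norm_exp_le_one_of_mem_skewAdjoint {x : A} (hx : star x = -x) :
    ‖NormedSpace.exp x‖ ≤ 1 := by
  let +nondep : NormedAlgebra ℚ A := .restrictScalars ℚ ℂ A
  rcases subsingleton_or_nontrivial A with h | h
  · rw [Subsingleton.elim (NormedSpace.exp x) 0, norm_zero]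
    exact zero_le_one
  have hu : star (NormedSpace.exp x) * NormedSpace.exp x = 1 := by
    rw [NormedSpace.star_exp, hx, ← NormedSpace.exp_add_of_commute (Commute.neg_left rfl)]
    simp
  have := CStarRing.norm_star_mul_self (x := NormedSpace.exp x)
  rw [hu, CStarRing.norm_one] at this
  nlinarith [norm_nonneg (NormedSpace.exp x)]

/-- Duhamel's argument: exp(tx) exp(-ty) has derivative exp(tx) (x - y) exp(-ty), of norm at most ‖x
- y‖ because both exponentials are contractions. The mean value inequality on [0, 1] bounds exp(x)
exp(-y) - 1, and multiplication by exp(y) finishes. -/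
theorem norm_exp_sub_exp_le_of_mem_skewAdjoint {x y : A} (hx : star x = -x) (hy : star y = -y) :
    ‖NormedSpace.exp x - NormedSpace.exp y‖ ≤ ‖x - y‖ := by
  let +nondep : NormedAlgebra ℚ A := .restrictScalars ℚ ℂ A
  have hb : ∀ (t : ℝ) {z : A}, star z = -z → ‖NormedSpace.exp (t • z)‖ ≤ 1 := fun t z hz =>
    norm_exp_le_one_of_mem_skewAdjoint (by rw [star_smul, hz]; simp)
  have hny : star (-y) = - -y := by rw [star_neg, hy]
  have hd : ∀ t : ℝ, HasDerivAt
      (fun t : ℝ => NormedSpace.exp (t • x) * NormedSpace.exp (t • (-y)))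
      (NormedSpace.exp (t • x) * (x - y) * NormedSpace.exp (t • (-y))) t := by
    intro t
    have h1 := hasDerivAt_exp_smul_const (𝕂 := ℝ) x t
    have h2 := hasDerivAt_exp_smul_const' (𝕂 := ℝ) (-y) t
    refine (h1.mul h2).congr_deriv ?_
    noncomm_ring
  have hm := Convex.norm_image_sub_le_of_norm_hasDerivWithin_le (s := univ) (C := ‖x - y‖)
    (x := (0 : ℝ)) (y := 1) (fun t _ => (hd t).hasDerivWithinAt) (fun t _ => by
      calc _ ≤ ‖NormedSpace.exp (t • x)‖ * ‖x - y‖ * ‖NormedSpace.exp (t • (-y))‖ :=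
            (norm_mul_le _ _).trans (by gcongr; exact norm_mul_le _ _)
        _ ≤ 1 * ‖x - y‖ * 1 := by gcongr <;> apply hb <;> assumption
        _ = ‖x - y‖ := by ring) convex_univ (mem_univ _) (mem_univ _)
  simp only [one_smul, zero_smul, NormedSpace.exp_zero, mul_one, sub_zero, norm_one] at hm
  have he : NormedSpace.exp x - NormedSpace.exp y
      = (NormedSpace.exp x * NormedSpace.exp (-y) - 1) * NormedSpace.exp y := by
    rw [sub_mul, mul_assoc, ← NormedSpace.exp_add_of_commute (Commute.neg_left rfl)]
    simp
  rw [he]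
  calc _ ≤ ‖NormedSpace.exp x * NormedSpace.exp (-y) - 1‖ * ‖NormedSpace.exp y‖ := norm_mul_le _ _
    _ ≤ ‖x - y‖ * 1 := by
      gcongr
      exact norm_exp_le_one_of_mem_skewAdjoint hy
    _ = _ := mul_one _

/-- The functional calculus of a self-adjoint element by an imaginary exponential. -/
theorem cfc_cexp_eq_exp {a : A} (ha : IsSelfAdjoint a) (s : ℝ) :
    cfc (fun z : ℂ => Complex.exp (Complex.I * s * z)) a
      = NormedSpace.exp ((Complex.I * s) • a) := by
  have hn : IsStarNormal a := ha.isStarNormal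
  have h1 : cfc (fun z : ℂ => Complex.I * s * z) a = (Complex.I * s) • a := by
    rw [cfc_const_mul_id ..]
  rw [cfc_comp' Complex.exp (fun z : ℂ => Complex.I * s * z) a, h1]
  refine CFC.complex_exp_eq_normedSpace_exp ?_
  rw [← h1]
  exact cfc_predicate _ _

theorem norm_cfc_cexp_sub_le {a b : A} (ha : IsSelfAdjoint a) (hb : IsSelfAdjoint b) (s : ℝ) :
    ‖cfc (fun z : ℂ => Complex.exp (Complex.I * s * z)) a
      - cfc (fun z : ℂ => Complex.exp (Complex.I * s * z)) b‖ ≤ |s| * ‖a - b‖ := by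
  have hs : ∀ {c : A}, IsSelfAdjoint c → star ((Complex.I * s) • c) = -((Complex.I * s) • c) := by
    intro c hc
    rw [star_smul, hc.star_eq]
    simp
  rw [cfc_cexp_eq_exp ha, cfc_cexp_eq_exp hb]
  refine (norm_exp_sub_exp_le_of_mem_skewAdjoint (hs ha) (hs hb)).trans ?_
  rw [← smul_sub, norm_smul]
  simp

/-- A function given on `[-R, R]` by a trigonometric series `∑ cₙ exp (i n ω x)` with
`∑ |n cₙ| < ∞` is operator Lipschitz. -/
theorem norm_cfc_sub_le_of_hasSum {f : ℝ → ℝ} {R ω : ℝ} {c : ℤ → ℂ}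
    (hc : Summable fun n => ‖c n‖) (hc1 : Summable fun n : ℤ => ‖c n‖ * |n * ω|)
    (hf : ∀ x ∈ Icc (-R) R,
      HasSum (fun n : ℤ => c n * Complex.exp (Complex.I * (n * ω : ℝ) * x)) (f x : ℂ))
    {a b : A} (ha : IsSelfAdjoint a) (hb : IsSelfAdjoint b) (haR : ‖a‖ ≤ R) (hbR : ‖b‖ ≤ R) :
    ‖cfc f a - cfc f b‖ ≤ (∑' n : ℤ, ‖c n‖ * |n * ω|) * ‖a - b‖ := by
  rcases subsingleton_or_nontrivial A with h | h
  · rw [Subsingleton.elim (cfc f a) (cfc f b), sub_self, norm_zero]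
    positivity
  set e : ℤ → ℂ → ℂ := fun n z => Complex.exp (Complex.I * (n * ω : ℝ) * z) with he
  have key : ∀ {d : A}, IsSelfAdjoint d → ‖d‖ ≤ R →
      HasSum (fun n => c n • cfc (e n) d) (cfc f d) := by
    intro d hd hdR
    have hn : IsStarNormal d := hd.isStarNormal
    have hspec : ∀ z ∈ spectrum ℂ d, z = (z.re : ℂ) ∧ z.re ∈ Icc (-R) R := by
      intro z hz
      have h1 := hd.mem_spectrum_eq_re hz
      refine ⟨h1, ?_⟩
      rw [mem_Icc, ← abs_le]
      exact (Complex.abs_re_le_norm z).trans ((spectrum.norm_le_norm_of_mem hz).trans hdR)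
    -- The exponentials are complex-valued, so the complex functional calculus is used. On the
    -- spectrum, which is real and lies in [-R, R], the n-th term is bounded by ‖c n‖, so the series
    -- converges uniformly there and the functional calculus preserves the limit.
    rw [cfc_real_eq_complex f hd]
    have hterm : ∀ n z, z ∈ spectrum ℂ d → ‖c n * e n z‖ ≤ ‖c n‖ := by
      intro n z hz
      rw [norm_mul, (hspec z hz).1, he]
      simp only
      have : Complex.I * (n * ω : ℝ) * (z.re : ℂ) = ((n * ω * z.re : ℝ) : ℂ) * Complex.I := by
        push_cast; ring
      rw [this, Complex.norm_exp_ofReal_mul_I, mul_one]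
    have hu := tendstoUniformlyOn_tsum hc hterm
    have hu2 : TendstoUniformlyOn (fun (t : Finset ℤ) z => ∑ n ∈ t, c n * e n z)
        (fun z => (f z.re : ℂ)) atTop (spectrum ℂ d) := by
      refine hu.congr_right fun z hz => ?_
      have := (hf z.re (hspec z hz).2).tsum_eq
      rw [← (hspec z hz).1] at this
      exact this
    have hcont : ∀ n, Continuous (e n) := fun n => by rw [he]; fun_prop
    have ht := tendsto_cfc_fun hu2 (Eventually.of_forall fun t => by fun_prop) 
    refine ht.congr fun t => ?_
    rw [show (fun z => ∑ n ∈ t, c n * e n z) = ∑ n ∈ t, fun z => c n * e n z by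
      ext z; simp, cfc_sum (fun n z => c n * e n z) d t (fun n _ => by fun_prop)]
    exact Finset.sum_congr rfl fun n _ => cfc_const_mul _ _ _ (by fun_prop)
  have hsum := (key ha haR).sub (key hb hbR)
  have hle : ∀ n : ℤ, ‖c n • cfc (e n) a - c n • cfc (e n) b‖ ≤ ‖c n‖ * |n * ω| * ‖a - b‖ := by
    intro n
    rw [← smul_sub, norm_smul, mul_assoc]
    gcongr
    exact norm_cfc_cexp_sub_le ha hb _
  rw [← tsum_mul_right, ← hsum.tsum_eq]
  exact tsum_of_norm_bounded (hc1.mul_right _).hasSum hle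

end Exponential

/-! ### Fourier series of C² functions. -/

section Fourier

/-- The Fourier coefficients of a `C²` function on `[a, b]` that vanishes to first order at the end
points: `∑ |n| |cₙ| < ∞`. -/
theorem summable_mul_norm_fourierCoeffOn {a b : ℝ} (hab : a < b) {h h' h'' : ℝ → ℂ}
    (hd : ∀ x, HasDerivAt h (h' x) x) (hd' : ∀ x, HasDerivAt h' (h'' x) x) (hc : Continuous h'')
    (ha : h a = 0) (hb : h b = 0) (ha' : h' a = 0) (hb' : h' b = 0) :
    Summable fun n : ℤ => |(n : ℝ)| * ‖fourierCoeffOn hab h n‖ := by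
  have hc' : Continuous h' := continuous_iff_continuousAt.2 fun x => (hd' x).continuousAt
  have hab0 : (0 : ℝ) < b - a := sub_pos.2 hab
  have hsq : Summable fun n : ℤ => ‖fourierCoeffOn hab h'' n‖ ^ 2 := by
    refine (hasSum_sq_fourierCoeffOn hab ?_).summable
    obtain ⟨C, hC⟩ := isCompact_Icc.exists_bound_of_continuousOn (s := Icc a b) hc.continuousOn
    refine MemLp.of_bound hc.aestronglyMeasurable C ?_
    filter_upwards [ae_restrict_mem measurableSet_Ioc] with x hx
    exact hC x (Ioc_subset_Icc_self hx)
  have hinv : Summable fun n : ℤ => 1 / (n : ℝ) ^ 2 := Real.summable_one_div_int_pow.2 one_lt_two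
  set q : ℝ := (b - a) / (2 * π) with hq
  have hq0 : 0 < q := by positivity
  -- Two integrations by parts; the vanishing of h and h' at the end points removes the boundary
  -- terms.
  have hcoef : ∀ n : ℤ, n ≠ 0 →
      ‖fourierCoeffOn hab h n‖ = (q / |(n : ℝ)|) ^ 2 * ‖fourierCoeffOn hab h'' n‖ := by
    intro n hn
    have hn' : (|(n : ℝ)|) ≠ 0 := by simpa using hn
    have hnorm : ‖(1 / (-2 * π * Complex.I * n) : ℂ)‖ = 1 / (2 * π * |(n : ℝ)|) := by
      simp [abs_of_pos Real.pi_pos]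
    have hnorm' : ‖((b : ℂ) - a)‖ = b - a := by
      rw [← Complex.ofReal_sub, Complex.norm_real, Real.norm_of_nonneg hab0.le]
    rw [fourierCoeffOn_of_hasDerivAt hab hn (fun x _ => hd x) (hc'.intervalIntegrable _ _),
      fourierCoeffOn_of_hasDerivAt hab hn (fun x _ => hd' x) (hc.intervalIntegrable _ _),
      ha, hb, ha', hb', sub_self, mul_zero, zero_sub, zero_sub, norm_mul, norm_neg, norm_mul, norm_mul,
      norm_neg, norm_mul, hnorm, hnorm', hq]
    field_simp
  refine Summable.of_nonneg_of_le (fun n => by positivity) (fun n => ?_)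
    ((hinv.add hsq).mul_left (q ^ 2))
  rcases eq_or_ne n 0 with rfl | hn
  · simp
    positivity
  · have hn' : 0 < |(n : ℝ)| := by simpa using hn
    rw [hcoef n hn, ← sq_abs (n : ℝ)]
    have : |(n : ℝ)| * ((q / |(n : ℝ)|) ^ 2 * ‖fourierCoeffOn hab h'' n‖)
        = q ^ 2 * (1 / |(n : ℝ)| * ‖fourierCoeffOn hab h'' n‖) := by
      field_simp
    rw [this, ← one_div_pow]
    gcongr
    -- With u = 1/|n| and w the modulus of the n-th coefficient of h'', this is u w ≤ u² + w²; the
    -- squares u² and w² are summable, the latter by Parseval.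
    nlinarith [sq_nonneg (1 / |(n : ℝ)| - ‖fourierCoeffOn hab h'' n‖),
      sq_nonneg (1 / |(n : ℝ)|), sq_nonneg (‖fourierCoeffOn hab h'' n‖)]

/-- A `C²` function is given on a compact interval by a trigonometric series whose termwise
derivative converges absolutely. -/
theorem exists_trigonometric_series {f : ℝ → ℝ} (hf : ContDiff ℝ 2 f) (R : ℝ) :
    ∃ (ω : ℝ) (c : ℤ → ℂ), (Summable fun n => ‖c n‖) ∧
      (Summable fun n : ℤ => ‖c n‖ * |n * ω|) ∧
      ∀ x ∈ Icc (-R) R,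
        HasSum (fun n : ℤ => c n * Complex.exp (Complex.I * (n * ω : ℝ) * x)) (f x : ℂ) := by
  set S : ℝ := |R| with hS
  have hS0 : 0 ≤ S := abs_nonneg R
  -- The bump is 1 on [-R, R] and vanishes beyond distance S + 2. The period 2(S + 3) puts the end
  -- points strictly outside the support, so g and g' vanish there. Taking S = |R| keeps the radii
  -- positive for every R.
  let χ : ContDiffBump (0 : ℝ) := ⟨S + 1, S + 2, by linarith, by linarith⟩
  have hg : ContDiff ℝ 2 fun x => χ x * f x := χ.contDiff.mul hf
  set g : ℝ → ℝ := fun x => χ x * f x with hgdef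
  have hg1 : ContDiff ℝ 1 (deriv g) := hg.deriv' 
  have hgd : ∀ x, HasDerivAt g (deriv g x) x := fun x =>
    ((hg.differentiable (by norm_num)) x).hasDerivAt
  have hgd' : ∀ x, HasDerivAt (deriv g) (deriv (deriv g) x) x := fun x =>
    ((hg1.differentiable (by norm_num)) x).hasDerivAt
  have hgc : Continuous (deriv (deriv g)) := hg1.continuous_deriv le_rfl
  have hzero : ∀ x : ℝ, S + 2 < |x| → g =ᶠ[𝓝 x] fun _ => 0 := by
    intro x hx
    filter_upwards [(isOpen_lt continuous_const continuous_abs).mem_nhds hx] with y hy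
    rw [hgdef]
    simp only
    rw [χ.zero_of_le_dist (by simpa [Real.dist_eq] using hy.le), zero_mul]
  have hz : ∀ x : ℝ, S + 2 < |x| → g x = 0 ∧ deriv g x = 0 := fun x hx =>
    ⟨(hzero x hx).eq_of_nhds, by rw [(hzero x hx).deriv_eq]; simp⟩
  set p : ℝ := 2 * (S + 3) with hp
  have : Fact (0 < p) := ⟨by positivity⟩
  set a : ℝ := -(S + 3) with ha
  have hae : S + 2 < |a| := by
    rw [ha, abs_neg, abs_of_nonneg (by positivity)]; linarith
  have hbe : S + 2 < |a + p| := by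
    rw [ha, hp, abs_of_nonneg (by linarith)]; linarith
  have hab : a < a + p := lt_add_of_pos_right a (Fact.out)
  set h : ℝ → ℂ := fun x => (g x : ℂ) with hh
  have hsum := summable_mul_norm_fourierCoeffOn hab (h := h) (h' := fun x => ((deriv g x : ℝ) : ℂ))
    (h'' := fun x => ((deriv (deriv g) x : ℝ) : ℂ)) (fun x => (hgd x).ofReal_comp)
    (fun x => (hgd' x).ofReal_comp) (Complex.continuous_ofReal.comp hgc)
    (by simp [hh, (hz _ hae).1]) (by simp [hh, (hz _ hbe).1])
    (by simp [(hz _ hae).2]) (by simp [(hz _ hbe).2])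
  -- Summability of |n| ‖cₙ‖ controls ‖cₙ‖ for n ≠ 0; the term n = 0 is added separately.
  have hcs : Summable fun n => ‖fourierCoeffOn hab h n‖ := by
    refine (hsum.add (summable_of_ne_finset_zero (s := {0})
      (f := fun n : ℤ => if n = 0 then ‖fourierCoeffOn hab h n‖ else 0) ?_)).of_nonneg_of_le
      (fun n => norm_nonneg _) fun n => ?_
    · intro n hn
      rw [Finset.mem_singleton] at hn
      simp [hn]
    · rcases eq_or_ne n 0 with rfl | hn
      · simp
      · have h1 : (1 : ℝ) ≤ |(n : ℝ)| := by
          rw [← Int.cast_abs]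
          exact_mod_cast Int.one_le_abs hn
        simp only [hn, if_false, add_zero]
        exact le_mul_of_one_le_left (norm_nonneg _) h1
  refine ⟨2 * π / p, fourierCoeffOn hab h, hcs, ?_, fun x hx => ?_⟩
  · refine (hsum.mul_left (|2 * π / p|)).congr fun n => ?_
    rw [abs_mul]
    ring
  · have hxS : |x| ≤ S := (abs_le.2 ⟨hx.1, hx.2⟩).trans (le_abs_self R)
    have hcont : Continuous (AddCircle.liftIco p a h) :=
      AddCircle.liftIco_continuous (by simp [hh, (hz _ hae).1, (hz _ hbe).1])
        (Complex.continuous_ofReal.comp hg.continuous).continuousOn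
    obtain ⟨F, hF⟩ : ∃ F : C(AddCircle p, ℂ), ⇑F = AddCircle.liftIco p a h := ⟨⟨_, hcont⟩, rfl⟩
    have hcoef : ∀ n, fourierCoeff F n = fourierCoeffOn hab h n := fun n =>
      (congrArg (fourierCoeff · n) hF).trans (fourierCoeff_liftIco_eq h n)
    have hs := has_pointwise_sum_fourier_series_of_summable (f := F)
      (by rw [funext hcoef]; exact hcs.of_norm) (x : AddCircle p)
    simp only [hcoef] at hs
    rw [hF] at hs
    rw [abs_le] at hxS
    rw [AddCircle.liftIco_coe_apply ⟨by linarith, by linarith⟩] at hs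
    have hfx : h x = f x := by
      have : χ x = 1 := χ.one_of_mem_closedBall (by
        rw [Metric.mem_closedBall, Real.dist_eq, sub_zero]
        exact abs_le.2 ⟨by linarith, by linarith⟩)
      simp [hh, hgdef, this]
    rw [hfx] at hs
    refine (congrArg (HasSum · _) (funext fun n => ?_)).mp hs
    rw [fourier_coe_apply, smul_eq_mul]
    congr 2
    push_cast
    ring

end Fourier

/-- `C²` functions are operator Lipschitz on bounded sets of self-adjoint elements. -/
theorem exists_norm_cfc_sub_le (A : Type*) [CStarAlgebra A] {f : ℝ → ℝ} (hf : ContDiff ℝ 2 f)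
    (R : ℝ) :
    ∃ C : ℝ, 0 ≤ C ∧ ∀ a b : A, IsSelfAdjoint a → IsSelfAdjoint b → ‖a‖ ≤ R → ‖b‖ ≤ R →
      ‖cfc f a - cfc f b‖ ≤ C * ‖a - b‖ := by
  obtain ⟨ω, c, hc, hc1, hs⟩ := exists_trigonometric_series hf R
  exact ⟨_, tsum_nonneg fun n => by positivity, fun a b ha hb haR hbR =>
    norm_cfc_sub_le_of_hasSum hc hc1 hs ha hb haR hbR⟩

/-! ### Tridiagonal operators and the Banach space of their coefficients. -/

namespace Toda

theorem norm_weightedShift_le (c : ℤ → ℂ) (hc : ∃ C : ℝ, ∀ n, ‖c n‖ ≤ C) (m : ℤ) {C : ℝ}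
    (hC : ∀ n, ‖c n‖ ≤ C) : ‖weightedShift c hc m‖ ≤ C := by
  have hC0 : 0 ≤ C := (norm_nonneg _).trans (hC 0)
  refine ContinuousLinearMap.opNorm_le_bound _ hC0 fun u => ?_
  refine abs_le_of_sq_le_sq' ?_ (by positivity) |>.2
  rw [sq_norm, mul_pow]
  exact (summable_weighted c C hC m u).2

theorem entry_weightedShift (c : ℤ → ℂ) (hc : ∃ C : ℝ, ∀ n, ‖c n‖ ≤ C) (m j k : ℤ) :
    entry (weightedShift c hc m) j k = if j + m = k then c j else 0 := by
  rw [entry, inner_delta, weightedShift_apply, delta_apply]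
  simp

theorem entry_add (S T : Hil →L[ℂ] Hil) (j k : ℤ) :
    entry (S + T) j k = entry S j k + entry T j k := by
  simp [entry]

theorem entry_sub (S T : Hil →L[ℂ] Hil) (j k : ℤ) :
    entry (S - T) j k = entry S j k - entry T j k := by
  simp [entry]

theorem entry_neg (T : Hil →L[ℂ] Hil) (j k : ℤ) : entry (-T) j k = -entry T j k := by
  simp [entry]

theorem entry_smul (r : ℝ) (T : Hil →L[ℂ] Hil) (j k : ℤ) :
    entry (r • T) j k = r • entry T j k := by
  simp [entry, inner_delta]

theorem entry_adjoint (T : Hil →L[ℂ] Hil) (j k : ℤ) : entry (star T) j k = star (entry T k j) := by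
  rw [ContinuousLinearMap.star_eq_adjoint, entry, entry, ContinuousLinearMap.adjoint_inner_right]
  exact (inner_conj_symm _ _).symm

/-- The coefficient sequences `(a, b)` of real symmetric tridiagonal operators, with the supremum
norm. -/
abbrev Coeff : Type := (ℤ →ᵇ ℝ) × (ℤ →ᵇ ℝ)

namespace Coeff

theorem abs_fst_le (x : Coeff) (n : ℤ) : |x.1 n| ≤ ‖x‖ :=
  (x.1.norm_coe_le_norm n).trans (norm_fst_le x)

theorem abs_snd_le (x : Coeff) (n : ℤ) : |x.2 n| ≤ ‖x‖ :=
  (x.2.norm_coe_le_norm n).trans (norm_snd_le x)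

theorem norm_le_of_forall {x : Coeff} {C : ℝ} (hC : 0 ≤ C) (h1 : ∀ n, |x.1 n| ≤ C)
    (h2 : ∀ n, |x.2 n| ≤ C) : ‖x‖ ≤ C :=
  norm_prod_le_iff.2
    ⟨(BoundedContinuousFunction.norm_le hC).2 h1, (BoundedContinuousFunction.norm_le hC).2 h2⟩

/-- The tridiagonal operator with off-diagonal coefficients `x.1` and diagonal coefficients
`x.2`. -/
def opFun (x : Coeff) : Hil →L[ℂ] Hil :=
  weightedShift (fun n => (x.1 n : ℂ)) ⟨‖x‖, fun n => by simpa using x.abs_fst_le n⟩ 1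
    + weightedShift (fun n => (x.1 (n - 1) : ℂ))
        ⟨‖x‖, fun n => by simpa using x.abs_fst_le (n - 1)⟩ (-1)
    + weightedShift (fun n => (x.2 n : ℂ)) ⟨‖x‖, fun n => by simpa using x.abs_snd_le n⟩ 0

theorem opFun_apply (x : Coeff) (u : Hil) (n : ℤ) :
    opFun x u n = x.1 n * u (n + 1) + x.1 (n - 1) * u (n - 1) + x.2 n * u n := by
  simp [opFun, sub_eq_add_neg]

theorem norm_opFun_le (x : Coeff) : ‖opFun x‖ ≤ 3 * ‖x‖ := by
  have h1 := norm_weightedShift_le (fun n => (x.1 n : ℂ))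
    ⟨‖x‖, fun n => by simpa using x.abs_fst_le n⟩ 1 (C := ‖x‖)
    (fun n => by simpa using x.abs_fst_le n)
  have h2 := norm_weightedShift_le (fun n => (x.1 (n - 1) : ℂ))
    ⟨‖x‖, fun n => by simpa using x.abs_fst_le (n - 1)⟩ (-1) (C := ‖x‖)
    (fun n => by simpa using x.abs_fst_le (n - 1))
  have h3 := norm_weightedShift_le (fun n => (x.2 n : ℂ))
    ⟨‖x‖, fun n => by simpa using x.abs_snd_le n⟩ 0 (C := ‖x‖)
    (fun n => by simpa using x.abs_snd_le n)
  refine (norm_add₃_le).trans ?_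
  linarith

/-- `opFun` as a bounded linear map. -/
def op : Coeff →L[ℝ] (Hil →L[ℂ] Hil) :=
  LinearMap.mkContinuous
    { toFun := opFun
      map_add' := fun x y => by
        ext u n
        simp only [opFun_apply, add_apply, lp.coeFn_add, Pi.add_apply,
          Prod.fst_add, Prod.snd_add, BoundedContinuousFunction.coe_add]
        push_cast
        ring
      map_smul' := fun r x => by
        ext u n
        simp only [opFun_apply, smul_apply, lp.coeFn_smul, Pi.smul_apply,
          Prod.smul_fst, Prod.smul_snd, BoundedContinuousFunction.coe_smul, RingHom.id_apply,
          smul_eq_mul, Complex.real_smul]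
        push_cast
        ring }
    3 norm_opFun_le

theorem op_apply (x : Coeff) (u : Hil) (n : ℤ) :
    op x u n = x.1 n * u (n + 1) + x.1 (n - 1) * u (n - 1) + x.2 n * u n :=
  opFun_apply x u n

theorem norm_op_le (x : Coeff) : ‖op x‖ ≤ 3 * ‖x‖ := norm_opFun_le x

theorem op_delta (x : Coeff) (k : ℤ) :
    op x (delta k) = (x.1 (k - 1) : ℂ) • delta (k - 1) + (x.2 k : ℂ) • delta k
      + (x.1 k : ℂ) • delta (k + 1) := by
  ext n
  rw [op_apply]
  simp only [lp.coeFn_add, Pi.add_apply, lp.coeFn_smul, Pi.smul_apply, delta_apply, smul_eq_mul]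
  by_cases h1 : n = k - 1
  · subst h1
    have e1 : ¬ k - 1 - 1 = k := by omega
    have e2 : ¬ k - 1 = k + 1 := by omega
    simp [e1, e2]
  by_cases h2 : n = k
  · subst h2
    have e1 : ¬ n = n - 1 := by omega
    simp [e1]
  by_cases h3 : n = k + 1
  · subst h3
    have e1 : ¬ k + 1 + 1 = k := by omega
    have e2 : ¬ k + 1 = k - 1 := by omega
    simp [e1, e2]
  have e1 : ¬ n + 1 = k := by omega
  have e2 : ¬ n - 1 = k := by omega
  simp [e1, e2, h1, h2, h3]

theorem entry_mul_op (S : Hil →L[ℂ] Hil) (x : Coeff) (j k : ℤ) :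
    entry (S * op x) j k = entry S j (k - 1) * x.1 (k - 1) + entry S j k * x.2 k
      + entry S j (k + 1) * x.1 k := by
  rw [entry, mul_apply_eq_comp, op_delta]
  simp only [map_add, map_smul, inner_add_right, inner_smul_right, entry]
  ring

theorem entry_op_mul (S : Hil →L[ℂ] Hil) (x : Coeff) (j k : ℤ) :
    entry (op x * S) j k = x.1 j * entry S (j + 1) k + x.1 (j - 1) * entry S (j - 1) k
      + x.2 j * entry S j k := by
  simp only [entry, inner_delta, mul_apply_eq_comp, op_apply]

theorem entry_op (x : Coeff) (j k : ℤ) :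
    entry (op x) j k = if k = j + 1 then (x.1 j : ℂ) else if j = k + 1 then (x.1 k : ℂ)
      else if j = k then (x.2 j : ℂ) else 0 := by
  rw [entry, inner_delta, op_apply]
  simp only [delta_apply]
  split_ifs <;> first | omega | (subst_vars; simp)

theorem isSelfAdjoint_op (x : Coeff) : IsSelfAdjoint (op x) := by
  apply clm_ext_entry
  intro j k
  rw [entry_adjoint, x.entry_op, x.entry_op]
  split_ifs <;> first | omega | (subst_vars; simp)

/-- The real parts of the coefficients of the two central diagonals of an operator. -/
def ofOp : (Hil →L[ℂ] Hil) →L[ℝ] Coeff :=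
  LinearMap.mkContinuous
    { toFun := fun T =>
        (BoundedContinuousFunction.ofNormedAddCommGroupDiscrete
          (fun n => (entry T n (n + 1)).re) ‖T‖
          fun _ => (Complex.abs_re_le_norm _).trans (norm_entry_le T _ _),
        BoundedContinuousFunction.ofNormedAddCommGroupDiscrete
          (fun n => (entry T n n).re) ‖T‖
          fun _ => (Complex.abs_re_le_norm _).trans (norm_entry_le T _ _))
      map_add' := fun S T => by
        ext n <;> simp [entry_add]
      map_smul' := fun r T => by
        ext n <;> simp [entry_smul] }
    1 fun T => by
      rw [one_mul]
      exact norm_le_of_forall (norm_nonneg _)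
        (fun _ => (Complex.abs_re_le_norm _).trans (norm_entry_le T _ _))
        (fun _ => (Complex.abs_re_le_norm _).trans (norm_entry_le T _ _))

theorem ofOp_fst (T : Hil →L[ℂ] Hil) (n : ℤ) : (ofOp T).1 n = (entry T n (n + 1)).re := rfl

theorem ofOp_snd (T : Hil →L[ℂ] Hil) (n : ℤ) : (ofOp T).2 n = (entry T n n).re := rfl

theorem norm_ofOp_le (T : Hil →L[ℂ] Hil) : ‖ofOp T‖ ≤ ‖T‖ :=
  norm_le_of_forall (norm_nonneg _)
    (fun _ => (Complex.abs_re_le_norm _).trans (norm_entry_le T _ _))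
    (fun _ => (Complex.abs_re_le_norm _).trans (norm_entry_le T _ _))

theorem ofOp_op (x : Coeff) : ofOp (op x) = x := by
  ext n
  · simp [ofOp_fst, entry_op]
  · simp [ofOp_snd, entry_op]

/-- Together with `norm_op_le` this makes the supremum norm and the operator norm equivalent on
tridiagonal operators, so limits and derivatives may be taken in either. -/
theorem norm_le_norm_op (x : Coeff) : ‖x‖ ≤ ‖op x‖ := by
  simpa [ofOp_op] using norm_ofOp_le (op x)

theorem supNorm_op (x : Coeff) : supNorm (op x) = ‖x‖ := by
  rw [supNorm, Prod.norm_def, BoundedContinuousFunction.norm_eq_iSup_norm,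
    BoundedContinuousFunction.norm_eq_iSup_norm]
  simp [entry_op]

end Coeff

/-- The coefficients of a Jacobi matrix. -/
def Jacobi.coeff (J : Jacobi) : Coeff := Coeff.ofOp J.op

theorem Jacobi.coeff_fst (J : Jacobi) (n : ℤ) : J.coeff.1 n = J.a n := by
  simp [coeff, Coeff.ofOp_fst, entry_op]

theorem Jacobi.coeff_snd (J : Jacobi) (n : ℤ) : J.coeff.2 n = J.b n := by
  simp [coeff, Coeff.ofOp_snd, entry_op]

theorem Jacobi.op_coeff (J : Jacobi) : Coeff.op J.coeff = J.op := by
  ext u n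
  rw [Coeff.op_apply, J.op_apply, coeff_fst, coeff_fst, coeff_snd]

theorem Jacobi.coeff_injective : Function.Injective Jacobi.coeff := fun J J' h => by
  ext n
  · rw [← coeff_fst, h, coeff_fst]
  · rw [← coeff_snd, h, coeff_snd]

theorem Coeff.exists_jacobi (x : Coeff) (hx : ∀ n, 0 < x.1 n) : ∃ J : Jacobi, J.coeff = x := by
  refine ⟨⟨x.1, x.2, hx, ⟨‖x‖, x.abs_fst_le⟩, ⟨‖x‖, x.abs_snd_le⟩⟩, ?_⟩
  ext n
  · rw [Jacobi.coeff_fst]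
  · rw [Jacobi.coeff_snd]

end Toda

/-! ### Uniform bounds and polynomial approximation for the functional calculus. -/

theorem spectrum_subset_Icc_of_norm_le {A : Type*} [CStarAlgebra A] {a : A} {R : ℝ} (hR : ‖a‖ ≤ R) : spectrum ℝ a ⊆ Icc (-R) R := by
  intro x hx
  rcases subsingleton_or_nontrivial A with h | h
  · simp [spectrum.of_subsingleton] at hx
  · rw [mem_Icc, ← abs_le]
    exact (spectrum.norm_le_norm_of_mem hx).trans hR

/-- On a bounded set of self-adjoint elements, the functional calculus of a continuous function is
uniformly approximated by real polynomials. -/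
theorem exists_polynomial_norm_cfc_sub_le (A : Type*) [CStarAlgebra A] {f : ℝ → ℝ}
    (hf : Continuous f) (R : ℝ) {ε : ℝ} (hε : 0 < ε) :
    ∃ p : Polynomial ℝ, ∀ a : A, IsSelfAdjoint a → ‖a‖ ≤ R →
      ‖cfc f a - Polynomial.aeval a p‖ ≤ ε := by
  obtain ⟨p, hp⟩ := exists_polynomial_near_of_continuousOn (-R) R f hf.continuousOn ε hε
  refine ⟨p, fun a ha haR => ?_⟩
  rw [← cfc_polynomial p a, ← cfc_sub f p.eval a hf.continuousOn p.continuous.continuousOn]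
  refine norm_cfc_le hε.le fun x hx => ?_
  rw [Real.norm_eq_abs, abs_sub_comm]
  exact (hp x (spectrum_subset_Icc_of_norm_le haR hx)).le

theorem exists_norm_cfc_le (A : Type*) [CStarAlgebra A] {f : ℝ → ℝ}
    (hf : Continuous f) (R : ℝ) :
    ∃ C : ℝ, 0 ≤ C ∧ ∀ a : A, IsSelfAdjoint a → ‖a‖ ≤ R → ‖cfc f a‖ ≤ C := by
  obtain ⟨C, hC⟩ := isCompact_Icc.exists_bound_of_continuousOn (s := Icc (-R) R) hf.continuousOn
  refine ⟨max C 0, le_max_right _ _, fun a ha haR => norm_cfc_le (le_max_right _ _) fun x hx => ?_⟩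
  exact (hC x (spectrum_subset_Icc_of_norm_le haR hx)).trans (le_max_left _ _)

/-! ### The Lax vector field in terms of the coefficients. -/

namespace Toda

section FunCalc

variable {H : Type*} [NormedAddCommGroup H] [InnerProductSpace ℂ H] [CompleteSpace H]

theorem isSelfAdjoint_funCalc (f : ℝ → ℝ) (T : H →L[ℂ] H) : IsSelfAdjoint (funCalc f T) :=
  cfc_predicate f T

theorem commute_funCalc (f : ℝ → ℝ) {T : H →L[ℂ] H} (hT : IsSelfAdjoint T) :
    Commute (funCalc f T) T := by
  have h := cfc_commute_cfc f id T
  rwa [cfc_id ℝ T] at h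

theorem funCalc_neg (f : ℝ → ℝ) (T : H →L[ℂ] H) : funCalc (fun t => -f t) T = -funCalc f T :=
  cfc_neg f T

theorem funCalc_polynomial (p : Polynomial ℝ) {T : H →L[ℂ] H} (hT : IsSelfAdjoint T) :
    funCalc p.eval T = Polynomial.aeval T p :=
  cfc_polynomial p T

end FunCalc

/-- The operator maps real sequences to real sequences. -/
def PreservesReal (T : Hil →L[ℂ] Hil) : Prop :=
  ∀ u : Hil, (∀ n, (u n).im = 0) → ∀ n, (T u n).im = 0

namespace PreservesReal

theorem entry_im {T : Hil →L[ℂ] Hil} (hT : PreservesReal T) (j k : ℤ) :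
    (entry T j k).im = 0 := by
  rw [entry, inner_delta]
  refine hT _ (fun n => ?_) j
  rw [delta_apply]
  split_ifs <;> simp

theorem add {S T : Hil →L[ℂ] Hil} (hS : PreservesReal S) (hT : PreservesReal T) :
    PreservesReal (S + T) := fun u hu n => by
  simp [hS u hu n, hT u hu n]

theorem mul {S T : Hil →L[ℂ] Hil} (hS : PreservesReal S) (hT : PreservesReal T) :
    PreservesReal (S * T) := fun u hu n => hS (T u) (hT u hu) n

theorem of_real (r : ℝ) : PreservesReal (algebraMap ℝ (Hil →L[ℂ] Hil) r) :=
  fun u hu n => by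
    simp [Algebra.algebraMap_eq_smul_one, hu n]

theorem aeval {T : Hil →L[ℂ] Hil} (hT : PreservesReal T) (p : Polynomial ℝ) :
    PreservesReal (Polynomial.aeval T p) := by
  induction p using Polynomial.induction_on with
  | C r => simpa using of_real r
  | add p q hp hq => simpa using hp.add hq
  | monomial n r h =>
    rw [pow_succ, ← mul_assoc, map_mul, Polynomial.aeval_X]
    exact h.mul hT

end PreservesReal

namespace Coeff

theorem preservesReal_op (x : Coeff) : PreservesReal (op x) := fun u hu n => by
  rw [op_apply]
  simp [hu]

/-- Each multiplication by a tridiagonal operator widens the band by at most one. Bandedness is what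
later makes the antisymmetric part of p(J) a bounded operator. -/
theorem entry_aeval_eq_zero (x : Coeff) (p : Polynomial ℝ) :
    ∃ N : ℤ, ∀ j k : ℤ, N < |j - k| → entry (Polynomial.aeval (op x) p) j k = 0 := by
  induction p using Polynomial.induction_on with
  | C r =>
    refine ⟨0, fun j k h => ?_⟩
    have hjk : j ≠ k := by rintro rfl; simp at h
    simp [Algebra.algebraMap_eq_smul_one, entry, inner_delta, delta_apply, hjk]
  | add p q hp hq =>
    obtain ⟨N, hN⟩ := hp
    obtain ⟨M, hM⟩ := hq
    refine ⟨max N M, fun j k h => ?_⟩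
    rw [map_add, entry_add, hN j k ((le_max_left _ _).trans_lt h),
      hM j k ((le_max_right _ _).trans_lt h), add_zero]
  | monomial n r h =>
    obtain ⟨N, hN⟩ := h
    refine ⟨N + 1, fun j k h => ?_⟩
    rw [pow_succ, ← mul_assoc, map_mul, Polynomial.aeval_X, entry_mul_op]
    rw [lt_abs] at h
    rw [hN, hN, hN]
    · simp
    all_goals rw [lt_abs]; omega

/-- Real polynomials in a real matrix are real matrices, and f(J) is a norm limit of these. -/
theorem entry_funCalc_im {f : ℝ → ℝ} (hf : Continuous f) (x : Coeff) (j k : ℤ) :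
    (entry (funCalc f (op x)) j k).im = 0 := by
  rw [← abs_nonpos_iff]
  refine le_of_forall_pos_le_add fun ε hε => ?_
  obtain ⟨p, hp⟩ := exists_polynomial_norm_cfc_sub_le (Hil →L[ℂ] Hil) hf ‖op x‖ hε
  have h1 := (norm_entry_le (funCalc f (op x) - Polynomial.aeval (op x) p) j k).trans
    (hp _ x.isSelfAdjoint_op le_rfl)
  have h2 := (Complex.abs_im_le_norm _).trans h1
  rwa [entry_sub, Complex.sub_im, (x.preservesReal_op.aeval p).entry_im, sub_zero,
    ← zero_add ε] at h2

theorem entry_symm {S : Hil →L[ℂ] Hil} (hS : IsSelfAdjoint S) (hr : ∀ j k, (entry S j k).im = 0)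
    (j k : ℤ) : entry S j k = entry S k j := by
  have h := entry_adjoint S j k
  rw [hS.star_eq] at h
  rw [h]
  exact Complex.conj_eq_iff_im.2 (hr k j)

theorem abs_mul_re_entry_le (x : Coeff) (S : Hil →L[ℂ] Hil) (n j k : ℤ) :
    |x.1 n * (entry S j k).re| ≤ ‖S‖ * ‖x‖ := by
  rw [abs_mul, mul_comm]
  exact mul_le_mul ((Complex.abs_re_le_norm _).trans (norm_entry_le S _ _)) (x.abs_fst_le _)
    (abs_nonneg _) (norm_nonneg _)

theorem abs_lax_fst_le (S : Hil →L[ℂ] Hil) (x : Coeff) (n : ℤ) :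
    |x.1 n * ((entry S (n + 1) (n + 1)).re - (entry S n n).re)| ≤ 4 * (‖S‖ * ‖x‖) := by
  rw [mul_sub]
  have h1 := x.abs_mul_re_entry_le S n (n + 1) (n + 1)
  have h2 := x.abs_mul_re_entry_le S n n n
  rw [abs_le] at *
  constructor <;> linarith

theorem abs_lax_snd_le (S : Hil →L[ℂ] Hil) (x : Coeff) (n : ℤ) :
    |2 * (x.1 n * (entry S n (n + 1)).re - x.1 (n - 1) * (entry S (n - 1) n).re)|
      ≤ 4 * (‖S‖ * ‖x‖) := by
  have h1 := x.abs_mul_re_entry_le S n n (n + 1)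
  have h2 := x.abs_mul_re_entry_le S (n - 1) (n - 1) n
  rw [abs_le] at *
  constructor <;> linarith

/-- The coefficients of `[S_a, J]`, as a function of a real symmetric operator `S` that commutes
with the tridiagonal operator `J` with coefficients `x`. -/
def lax (S : Hil →L[ℂ] Hil) (x : Coeff) : Coeff :=
  (BoundedContinuousFunction.ofNormedAddCommGroupDiscrete
      (fun n => x.1 n * ((entry S (n + 1) (n + 1)).re - (entry S n n).re)) _ (abs_lax_fst_le S x),
    BoundedContinuousFunction.ofNormedAddCommGroupDiscrete
      (fun n => 2 * (x.1 n * (entry S n (n + 1)).re - x.1 (n - 1) * (entry S (n - 1) n).re)) _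
      (abs_lax_snd_le S x))

theorem lax_fst (S : Hil →L[ℂ] Hil) (x : Coeff) (n : ℤ) :
    (lax S x).1 n = x.1 n * ((entry S (n + 1) (n + 1)).re - (entry S n n).re) := rfl

theorem lax_snd (S : Hil →L[ℂ] Hil) (x : Coeff) (n : ℤ) :
    (lax S x).2 n
      = 2 * (x.1 n * (entry S n (n + 1)).re - x.1 (n - 1) * (entry S (n - 1) n).re) := rfl

/-- Single entries of S are bounded by ‖S‖, so this holds although S ↦ S_a is not bounded for the
operator norm. With additivity in both arguments it yields the Lipschitz estimate for the field. -/
theorem norm_lax_le (S : Hil →L[ℂ] Hil) (x : Coeff) : ‖lax S x‖ ≤ 4 * (‖S‖ * ‖x‖) :=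
  norm_le_of_forall (by positivity) (abs_lax_fst_le S x) (abs_lax_snd_le S x)

theorem lax_sub_left (S S' : Hil →L[ℂ] Hil) (x : Coeff) :
    lax (S - S') x = lax S x - lax S' x := by
  ext n
  · simp only [lax_fst, Prod.fst_sub, BoundedContinuousFunction.coe_sub, Pi.sub_apply, entry_sub,
      Complex.sub_re]
    ring
  · simp only [lax_snd, Prod.snd_sub, BoundedContinuousFunction.coe_sub, Pi.sub_apply, entry_sub,
      Complex.sub_re]
    ring

theorem lax_sub_right (S : Hil →L[ℂ] Hil) (x x' : Coeff) :
    lax S (x - x') = lax S x - lax S x' := by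
  ext n
  · simp only [lax_fst, Prod.fst_sub, BoundedContinuousFunction.coe_sub, Pi.sub_apply]
    ring
  · simp only [lax_snd, Prod.fst_sub, Prod.snd_sub, BoundedContinuousFunction.coe_sub,
      Pi.sub_apply]
    ring

/-- The commutator `[S_a, J]` is tridiagonal, with coefficients `lax S x`. -/
theorem antisymPart_commutator {S : Hil →L[ℂ] Hil} {x : Coeff} (hS : IsSelfAdjoint S)
    (hr : ∀ j k, (entry S j k).im = 0) (hc : Commute S (op x)) (j k : ℤ) :
    (antisymPart (entry S) j (k - 1) * x.1 (k - 1) + antisymPart (entry S) j k * x.2 k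
        + antisymPart (entry S) j (k + 1) * x.1 k)
      - (x.1 j * antisymPart (entry S) (j + 1) k + x.1 (j - 1) * antisymPart (entry S) (j - 1) k
        + x.2 j * antisymPart (entry S) j k) = entry (op (lax S x)) j k := by
  have hsymm := entry_symm hS hr
  have hre : ∀ j k, (((entry S j k).re : ℝ) : ℂ) = entry S j k := fun j k =>
    Complex.ext rfl (by simp [hr])
  have hcomm : ∀ j k, entry S j (k - 1) * x.1 (k - 1) + entry S j k * x.2 k
      + entry S j (k + 1) * x.1 k
      = x.1 j * entry S (j + 1) k + x.1 (j - 1) * entry S (j - 1) k + x.2 j * entry S j k := by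
    intro j k
    rw [← entry_mul_op, hc.eq, entry_op_mul]
  have up : ∀ {j k : ℤ}, j < k → antisymPart (entry S) j k = entry S j k := fun h => by
    simp [antisymPart, h]
  have down : ∀ {j k : ℤ}, k < j → antisymPart (entry S) j k = -entry S j k := fun h => by
    simp [antisymPart, h, h.not_gt]
  have diag : ∀ j : ℤ, antisymPart (entry S) j j = 0 := fun j => by simp [antisymPart]
  rw [entry_op]
  rcases lt_trichotomy j k with hjk | rfl | hjk
  · rcases (by omega : k = j + 1 ∨ j + 1 < k) with rfl | h
    -- On the superdiagonal S_a agrees with S except that the two diagonal entries of S are missing;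
    -- since [S, J] = 0, what remains is minus their contribution.
    · have h := hcomm j (j + 1)
      rw [if_pos rfl, lax_fst]
      simp only [add_sub_cancel_right] at h ⊢
      rw [diag, diag, up (by omega), up (by omega), up (by omega)]
      push_cast
      rw [hre, hre]
      linear_combination h
    -- Farther up only entries above the diagonal occur, so the expression is an entry of [S, J] =
    -- 0. Below the diagonal the same happens with the opposite sign.
    · rw [if_neg (by omega), if_neg (by omega), if_neg (by omega), up (by omega), up (by omega),
        up (by omega), up (by omega), up (by omega)]
      linear_combination hcomm j k
  -- On the diagonal the sign change makes symmetric entries add up instead of cancel, whence the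
  -- factor 2; only symmetry of S is needed.
  · rw [if_neg (by omega), if_neg (by omega), if_pos rfl, lax_snd, diag, down (by omega),
      up (by omega), down (by omega), up (by omega), hsymm j (j - 1), hsymm (j + 1) j]
    push_cast
    rw [hre, hre]
    ring
  · rcases (by omega : j = k + 1 ∨ k + 1 < j) with rfl | h
    · have h := hcomm (k + 1) k
      rw [if_neg (by omega), if_pos rfl, lax_fst]
      simp only [add_sub_cancel_right] at h ⊢
      rw [diag, diag, down (by omega), down (by omega), down (by omega)]
      push_cast
      rw [hre, hre]
      linear_combination -h
    · rw [if_neg (by omega), if_neg (by omega), if_neg (by omega), down (by omega),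
        down (by omega), down (by omega), down (by omega), down (by omega)]
      linear_combination -hcomm j k

/-- The vector field of the Lax equation, in terms of the coefficients. -/
def field (f : ℝ → ℝ) (x : Coeff) : Coeff := lax (funCalc f (op x)) x

/-- Used to reverse time: the backward flow of f is the forward flow of -f. -/
theorem field_neg (f : ℝ → ℝ) (x : Coeff) : field (fun t => -f t) x = -field f x := by
  have h : funCalc (fun t => -f t) (op x) = 0 - funCalc f (op x) := by
    rw [zero_sub, funCalc_neg]
  rw [field, h, lax_sub_left, field]
  have : lax 0 x = 0 := by
    rw [← norm_le_zero_iff]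
    simpa using norm_lax_le 0 x
  rw [this, zero_sub]

end Coeff

theorem matMul_op_right (A : ℤ → ℤ → ℂ) (J : Jacobi) (j k : ℤ) :
    matMul A (entry J.op) j k = A j (k - 1) * J.a (k - 1) + A j k * J.b k + A j (k + 1) * J.a k := by
  have hs : matMul A (entry J.op) j k
      = ∑ l ∈ {k - 1, k, k + 1}, A j l * entry J.op l k := by
    apply tsum_eq_sum
    intro l hl
    rw [J.entry_op_eq_zero, mul_zero]
    simp only [Finset.mem_insert, Finset.mem_singleton] at hl
    rw [lt_abs]
    omega
  rw [hs, Finset.sum_insert (by simp; omega), Finset.sum_insert (by simp), Finset.sum_singleton,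
    J.entry_op, J.entry_op, J.entry_op]
  have e2 : ¬ k = k + 1 + 1 := by omega
  simp [e2]
  ring

theorem matMul_op_left (A : ℤ → ℤ → ℂ) (J : Jacobi) (j k : ℤ) :
    matMul (entry J.op) A j k
      = J.a j * A (j + 1) k + J.a (j - 1) * A (j - 1) k + J.b j * A j k := by
  have hs : matMul (entry J.op) A j k
      = ∑ l ∈ {j - 1, j, j + 1}, entry J.op j l * A l k := by
    apply tsum_eq_sum
    intro l hl
    rw [J.entry_op_eq_zero, zero_mul]
    simp only [Finset.mem_insert, Finset.mem_singleton] at hl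
    rw [lt_abs]
    omega
  rw [hs, Finset.sum_insert (by simp; omega), Finset.sum_insert (by simp), Finset.sum_singleton,
    J.entry_op, J.entry_op, J.entry_op]
  have e2 : ¬ j - 1 = j + 1 := by omega
  simp [e2]
  ring

theorem laxField_eq {f : ℝ → ℝ} (hf : Continuous f) (J : Jacobi) :
    laxField f J = Coeff.op (Coeff.field f J.coeff) := by
  apply clm_ext_entry
  intro j k
  rw [entry_laxField, laxEntry]
  split_ifs with h
  · rw [matMul_op_right, matMul_op_left, Coeff.field,
      ← Coeff.antisymPart_commutator (isSelfAdjoint_funCalc f _)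
        (J.coeff.entry_funCalc_im hf) (commute_funCalc f J.coeff.isSelfAdjoint_op), J.op_coeff]
    simp only [J.coeff_fst, J.coeff_snd]
  · rw [Coeff.entry_op]
    rw [abs_le] at h
    rw [if_neg (by omega), if_neg (by omega), if_neg (by omega)]

end Toda

/-! ### The operator norm does not grow along the flow. -/

/-- To first order in `h`, perturbing by `h • [b, a]` with skew-adjoint `b` does not increase the
norm. -/
theorem norm_add_smul_commutator_le {A : Type*} [CStarAlgebra A] (a : A) {b : A}
    (hb : star b = -b) (h : ℝ) :
    ‖a + h • (b * a - a * b)‖ ≤ ‖a‖ + 2 * h ^ 2 * ‖b‖ ^ 2 * ‖a‖ := by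
  rcases subsingleton_or_nontrivial A with hA | hA
  · rw [Subsingleton.elim (a + h • (b * a - a * b)) 0, norm_zero]
    positivity
  -- Skew-adjointness cancels the first-order term in (1 + hb)*(1 + hb) = 1 - h²b². The perturbed
  -- element is (1 + hb) a (1 - hb) + h² bab, and each summand contributes one of the two h² terms.
  have hn : ‖1 + h • b‖ ^ 2 ≤ 1 + h ^ 2 * ‖b‖ ^ 2 := by
    rw [sq, ← CStarRing.norm_star_mul_self]
    have : star (1 + h • b) * (1 + h • b) = 1 - h ^ 2 • (b * b) := by
      rw [star_add, star_one, star_smul, hb, star_trivial]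
      simp only [add_mul, mul_add, one_mul, mul_one, smul_neg, neg_mul, smul_mul_smul_comm, sq h]
      abel
    rw [this]
    refine (norm_sub_le _ _).trans ?_
    rw [CStarRing.norm_one, norm_smul, norm_pow, Real.norm_eq_abs, sq_abs, sq ‖b‖]
    gcongr
    exact norm_mul_le _ _
  have hn' : ‖1 - h • b‖ = ‖1 + h • b‖ := by
    rw [← norm_star (1 + h • b), star_add, star_one, star_smul, hb, star_trivial, smul_neg,
      sub_eq_add_neg]
  have he : a + h • (b * a - a * b)
      = (1 + h • b) * a * (1 - h • b) + h ^ 2 • (b * a * b) := by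
    simp only [add_mul, mul_sub, one_mul, mul_one, smul_mul_assoc, mul_smul_comm, smul_sub,
      smul_add, smul_smul, sq h]
    abel
  rw [he]
  calc _ ≤ ‖1 + h • b‖ * ‖a‖ * ‖1 - h • b‖ + h ^ 2 * (‖b‖ * ‖a‖ * ‖b‖) := by
        refine (norm_add_le _ _).trans (add_le_add ?_ ?_)
        · exact (norm_mul_le _ _).trans (by gcongr; exact norm_mul_le _ _)
        · rw [norm_smul, norm_pow, Real.norm_eq_abs, sq_abs]
          gcongr
          exact (norm_mul_le _ _).trans (by gcongr; exact norm_mul_le _ _)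
    _ = ‖1 + h • b‖ ^ 2 * ‖a‖ + h ^ 2 * ‖b‖ ^ 2 * ‖a‖ := by rw [hn']; ring
    _ ≤ (1 + h ^ 2 * ‖b‖ ^ 2) * ‖a‖ + h ^ 2 * ‖b‖ ^ 2 * ‖a‖ := by gcongr
    _ = _ := by ring

namespace Toda

namespace Coeff

/-- On bounded sets of operators, the vector field is Lipschitz with respect to the supremum norm
of the coefficients. -/
theorem exists_norm_field_sub_le {f : ℝ → ℝ} (hf : ContDiff ℝ 2 f) (R : ℝ) :
    ∃ L : ℝ≥0, ∀ x y : Coeff, ‖op x‖ ≤ R → ‖op y‖ ≤ R →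
      ‖field f x - field f y‖ ≤ L * ‖x - y‖ := by
  obtain ⟨C, hC0, hC⟩ := exists_norm_cfc_sub_le (Hil →L[ℂ] Hil) hf R
  obtain ⟨M, hM0, hM⟩ := exists_norm_cfc_le (Hil →L[ℂ] Hil) hf.continuous R
  -- The 4 is the constant of `norm_lax_le`; 12 includes the 3 of `norm_op_le`, which turns the
  -- operator Lipschitz bound into one for coefficients.
  refine ⟨(12 * C * |R| + 4 * M).toNNReal, fun x y hx hy => ?_⟩
  have h1 : ‖funCalc f (op x) - funCalc f (op y)‖ ≤ C * ‖op x - op y‖ :=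
    hC _ _ x.isSelfAdjoint_op y.isSelfAdjoint_op hx hy
  have h2 : ‖funCalc f (op y)‖ ≤ M := hM _ y.isSelfAdjoint_op hy
  have h3 : ‖op x - op y‖ ≤ 3 * ‖x - y‖ := by
    rw [← map_sub]
    exact norm_op_le _
  have h4 : ‖x‖ ≤ |R| := x.norm_le_norm_op.trans (hx.trans (le_abs_self R))
  have he : field f x - field f y
      = lax (funCalc f (op x) - funCalc f (op y)) x + lax (funCalc f (op y)) (x - y) := by
    rw [lax_sub_left, lax_sub_right, field, field]
    abel
  rw [he, Real.coe_toNNReal _ (by positivity)]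
  calc _ ≤ 4 * (‖funCalc f (op x) - funCalc f (op y)‖ * ‖x‖)
        + 4 * (‖funCalc f (op y)‖ * ‖x - y‖) :=
        (norm_add_le _ _).trans (add_le_add (norm_lax_le _ _) (norm_lax_le _ _))
    _ ≤ 4 * ((C * (3 * ‖x - y‖)) * |R|) + 4 * (M * ‖x - y‖) := by
        gcongr
        exact h1.trans (by gcongr)
    _ = _ := by ring

theorem exists_norm_field_le {f : ℝ → ℝ} (hf : Continuous f) (R : ℝ) :
    ∃ M : ℝ≥0, ∀ x : Coeff, ‖op x‖ ≤ R → ‖field f x‖ ≤ M := by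
  obtain ⟨M, hM0, hM⟩ := exists_norm_cfc_le (Hil →L[ℂ] Hil) hf R
  refine ⟨(4 * (M * |R|)).toNNReal, fun x hx => ?_⟩
  have h2 : ‖funCalc f (op x)‖ ≤ M := hM _ x.isSelfAdjoint_op hx
  have h4 : ‖x‖ ≤ |R| := x.norm_le_norm_op.trans (hx.trans (le_abs_self R))
  rw [Real.coe_toNNReal _ (by positivity)]
  refine (norm_lax_le _ _).trans ?_
  gcongr

end Coeff

/-- The antisymmetric part of a banded operator is a bounded operator. -/
theorem exists_entry_eq_antisymPart (S : Hil →L[ℂ] Hil) {N : ℤ}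
    (hN : ∀ j k : ℤ, N < |j - k| → entry S j k = 0) :
    ∃ B : Hil →L[ℂ] Hil, ∀ j k, entry B j k = antisymPart (entry S) j k := by
  refine ⟨∑ m ∈ Finset.Icc (-N) N, weightedShift (fun n => antisymPart (entry S) n (n + m))
    ⟨‖S‖, fun n => norm_antisymPart_le S _ _⟩ m, fun j k => ?_⟩
  have hsum : ∀ (s : Finset ℤ) (T : ℤ → Hil →L[ℂ] Hil),
      entry (∑ m ∈ s, T m) j k = ∑ m ∈ s, entry (T m) j k := fun s T => by
    simp only [entry, sum_apply, inner_sum]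
  rw [hsum]
  simp only [entry_weightedShift]
  by_cases h : N < |j - k|
  · have h0 : antisymPart (entry S) j k = 0 := by simp [antisymPart, hN j k h]
    rw [h0]
    refine Finset.sum_eq_zero fun m hm => ?_
    rw [Finset.mem_Icc] at hm
    rw [lt_abs] at h
    rw [if_neg (by omega)]
  · rw [Finset.sum_eq_single (k - j)]
    · simp
    · intro m _ hm
      rw [if_neg (by omega)]
    · intro hm
      rw [not_lt, abs_le] at h
      rw [Finset.mem_Icc] at hm
      omega

namespace Coeff

/-- B is the antisymmetric part of p(J), which is bounded because p(J) is banded. For continuous f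
the approximation by such commutators replaces any use of f(J)_a as an operator. -/
theorem exists_commutator_polynomial (x : Coeff) (p : Polynomial ℝ) :
    ∃ B : Hil →L[ℂ] Hil, star B = -B ∧
      op (lax (Polynomial.aeval (op x) p) x) = B * op x - op x * B := by
  obtain ⟨N, hN⟩ := x.entry_aeval_eq_zero p
  obtain ⟨B, hB⟩ := exists_entry_eq_antisymPart _ hN
  set S := Polynomial.aeval (op x) p with hS
  have hsa : IsSelfAdjoint S := by
    have h := isSelfAdjoint_funCalc p.eval (op x)
    have : funCalc p.eval (op x) = S := funCalc_polynomial p x.isSelfAdjoint_op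
    rwa [this] at h
  have hr : ∀ j k, (entry S j k).im = 0 := (x.preservesReal_op.aeval p).entry_im
  have hc : Commute S (op x) := by
    have h := commute_funCalc p.eval x.isSelfAdjoint_op
    have : funCalc p.eval (op x) = S := funCalc_polynomial p x.isSelfAdjoint_op
    rwa [this] at h
  refine ⟨B, ?_, ?_⟩
  · apply clm_ext_entry
    intro j k
    rw [entry_adjoint, entry_neg, hB, hB]
    have h := hsa.star_eq
    have hstar : ∀ j k, star (entry S j k) = entry S k j := fun j k => by
      rw [← entry_adjoint, h]
    unfold antisymPart
    split_ifs <;> first | omega | simp [hstar, -RCLike.star_def]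
  · apply clm_ext_entry
    intro j k
    rw [← antisymPart_commutator hsa hr hc, entry_sub, entry_mul_op, entry_op_mul]
    simp only [hB]

/-- The vector field of the Lax equation is a limit of commutators with skew-adjoint operators. -/
theorem exists_norm_op_field_sub_commutator_le {f : ℝ → ℝ} (hf : Continuous f) (x : Coeff) {ε : ℝ}
    (hε : 0 < ε) :
    ∃ B : Hil →L[ℂ] Hil, star B = -B ∧ ‖op (field f x) - (B * op x - op x * B)‖ ≤ ε := by
  -- 12 = 3 · 4 from `norm_op_le` and `norm_lax_le`; the +1 keeps the denominator positive.
  obtain ⟨p, hp⟩ := exists_polynomial_norm_cfc_sub_le (Hil →L[ℂ] Hil) hf ‖op x‖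
    (ε := ε / (12 * (‖x‖ + 1))) (by positivity)
  obtain ⟨B, hB, hBx⟩ := x.exists_commutator_polynomial p
  refine ⟨B, hB, ?_⟩
  have hp' : ‖funCalc f (op x) - Polynomial.aeval (op x) p‖ ≤ ε / (12 * (‖x‖ + 1)) :=
    hp _ x.isSelfAdjoint_op le_rfl
  rw [← hBx, ← map_sub, field, ← lax_sub_left]
  calc _ ≤ 3 * (4 * (ε / (12 * (‖x‖ + 1)) * (‖x‖ + 1))) := by
        refine (norm_op_le _).trans ?_
        gcongr
        refine (norm_lax_le _ _).trans ?_
        gcongr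
        linarith
    _ = ε := by
        field_simp
        norm_num

/-- Along a curve tangent to the vector field, the operator norm is stationary to first order. -/
theorem eventually_norm_op_le {f : ℝ → ℝ} (hf : Continuous f) {y : ℝ → Coeff} {t : ℝ}
    (hy : HasDerivAt y (field f (y t)) t) {ε : ℝ} (hε : 0 < ε) :
    ∀ᶠ z in 𝓝 t, ‖op (y z)‖ ≤ ‖op (y t)‖ + ε * |z - t| := by
  obtain ⟨B, hB, hBle⟩ := exists_norm_op_field_sub_commutator_le hf (y t) (ε := ε / 3)
    (by positivity)
  -- Three errors of size ε/3: the approximation by a commutator, the second-order term, and the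
  -- remainder of the derivative, which is taken as ε/9 since `op` costs a factor 3.
  have h1 := (hasDerivAt_iff_isLittleO.1 hy).def (c := ε / 9) (by positivity)
  have h2 : ∀ᶠ z in 𝓝 t, |z - t| * (2 * ‖B‖ ^ 2 * ‖op (y t)‖) < ε / 3 := by
    have hcont : Continuous fun z : ℝ => |z - t| * (2 * ‖B‖ ^ 2 * ‖op (y t)‖) := by fun_prop
    refine hcont.continuousAt.eventually_lt continuousAt_const ?_
    simp
    positivity
  filter_upwards [h1, h2] with z hz1 hz2
  have he : op (y z) = (op (y t) + (z - t) • (B * op (y t) - op (y t) * B))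
      + (z - t) • (op (field f (y t)) - (B * op (y t) - op (y t) * B))
      + op (y z - y t - (z - t) • field f (y t)) := by
    rw [map_sub, map_sub, map_smul, smul_sub (z - t) (op (field f (y t)))]
    abel
  have n1 : ‖op (y t) + (z - t) • (B * op (y t) - op (y t) * B)‖
      ≤ ‖op (y t)‖ + 2 * (z - t) ^ 2 * ‖B‖ ^ 2 * ‖op (y t)‖ :=
    norm_add_smul_commutator_le (op (y t)) hB (z - t)
  have n2 : ‖(z - t) • (op (field f (y t)) - (B * op (y t) - op (y t) * B))‖
      ≤ |z - t| * (ε / 3) := by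
    rw [norm_smul, Real.norm_eq_abs]
    gcongr
  have n3 : ‖op (y z - y t - (z - t) • field f (y t))‖ ≤ 3 * (ε / 9 * |z - t|) :=
    (norm_op_le _).trans (by gcongr; exact hz1)
  have n4 : 2 * (z - t) ^ 2 * ‖B‖ ^ 2 * ‖op (y t)‖ ≤ |z - t| * (ε / 3) := by
    rw [← sq_abs (z - t)]
    calc _ = |z - t| * (|z - t| * (2 * ‖B‖ ^ 2 * ‖op (y t)‖)) := by ring
      _ ≤ _ := by gcongr
  rw [he]
  refine norm_add₃_le.trans ?_
  linarith

/-- The norm is compared with the line R + εs. As long as that line is below ρ, the curve follows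
the true field at any contact point, where the norm has upper slope at most 0 < ε, so the line
cannot be crossed. Then ε tends to 0. -/
theorem norm_op_le_of_nonneg {f : ℝ → ℝ} (hf : Continuous f) {v : Coeff → Coeff} {R ρ : ℝ}
    (hR : R < ρ) (hv : ∀ x, ‖op x‖ < ρ → v x = field f x) {y : ℝ → Coeff}
    (hy : ∀ t, HasDerivAt y (v (y t)) t) (h0 : ‖op (y 0)‖ ≤ R) {t : ℝ} (ht : 0 ≤ t) :
    ‖op (y t)‖ ≤ R := by
  have hd : ∀ t, HasDerivAt (fun t => op (y t)) (op (v (y t))) t := fun t =>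
    op.hasFDerivAt.comp_hasDerivAt t (hy t)
  have key : ∀ ε : ℝ, 0 < ε → R + ε * t < ρ → ‖op (y t)‖ ≤ R + ε * t := by
    intro ε hε hερ
    refine image_le_of_liminf_slope_right_lt_deriv_boundary (f := fun s => ‖op (y s)‖)
      -- The second branch only supplies some slope bound where the norm is at least ρ; the
      -- comparison with ε is made at contact points, where the first branch applies.
      (f' := fun s => if ‖op (y s)‖ < ρ then 0 else ‖op (v (y s))‖) (a := 0) (b := t)
      (B := fun s => R + ε * s) (B' := fun _ => ε)
      (continuous_iff_continuousAt.2 fun s => (hd s).continuousAt.norm).continuousOn ?_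
      (by simpa using h0) (fun s => by
        simpa using ((hasDerivAt_id s).const_mul ε).const_add R) ?_ ⟨ht, le_rfl⟩
    · intro s _ r hr
      split_ifs at hr with hs
      · have hys : HasDerivAt y (field f (y s)) s := hv _ hs ▸ hy s
        have := (eventually_norm_op_le hf hys (half_pos hr)).filter_mono
          (nhdsWithin_le_nhds (s := Ioi s))
        refine (this.and self_mem_nhdsWithin).frequently.mono fun z hz => ?_
        obtain ⟨hz, hsz⟩ := hz
        have hsz' : 0 < z - s := sub_pos.2 hsz
        rw [slope_def_field, div_lt_iff₀ hsz']
        rw [abs_of_pos hsz'] at hz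
        nlinarith
      · have := (hd s).hasDerivWithinAt (s := Ici s) |>.liminf_right_slope_norm_le hr
        refine this.mono fun z hz => ?_
        rwa [slope_def_field, div_eq_inv_mul]
    · intro s hs hsB
      have : ‖op (y s)‖ < ρ := by
        rw [hsB]
        nlinarith [hs.2]
      simp [this, hε]
  refine le_of_forall_pos_le_add fun δ hδ => ?_
  have h1 : 0 < t + 1 := by linarith
  -- Ensures εt ≤ δ and R + εt < ρ; t + 1 avoids division by zero at t = 0.
  set ε : ℝ := min δ ((ρ - R) / 2) / (t + 1) with hε
  have hm : 0 < min δ ((ρ - R) / 2) := lt_min hδ (by linarith)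
  have hε0 : 0 < ε := div_pos hm h1
  have hεt : ε * t ≤ min δ ((ρ - R) / 2) := by
    calc ε * t ≤ ε * (t + 1) := by nlinarith
      _ = _ := div_mul_cancel₀ _ h1.ne'
  have h2 := hεt.trans (min_le_left _ _)
  have h3 := hεt.trans (min_le_right _ _)
  exact (key ε hε0 (by linarith)).trans (by linarith)

/-- The Lax equation does not increase the operator norm, in either direction of time. It is enough
that the curve follows the vector field as long as its norm is less than `ρ`. -/
theorem norm_op_le_of_hasDerivAt {f : ℝ → ℝ} (hf : Continuous f) {v : Coeff → Coeff} {R ρ : ℝ}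
    (hR : R < ρ) (hv : ∀ x, ‖op x‖ < ρ → v x = field f x) {y : ℝ → Coeff}
    (hy : ∀ t, HasDerivAt y (v (y t)) t) (h0 : ‖op (y 0)‖ ≤ R) (t : ℝ) :
    ‖op (y t)‖ ≤ R := by
  rcases le_total 0 t with ht | ht
  · exact norm_op_le_of_nonneg hf hR hv hy h0 ht
  · have hy' : ∀ s, HasDerivAt (fun s => y (-s)) (-v (y (-s))) s := fun s =>
      ((hy (-s)).scomp s (hasDerivAt_neg s)).congr_deriv (by simp)
    have := norm_op_le_of_nonneg (f := fun s => -f s) hf.neg (v := fun x => -v x) hR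
      (fun x hx => by rw [field_neg, hv x hx]) hy' (by simpa using h0) (neg_nonneg.2 ht)
    simpa using this

end Coeff

end Toda

/-! ### Global solutions, their uniqueness and positivity. -/

/-- Global existence for a bounded and globally Lipschitz autonomous vector field. -/
theorem exists_forall_hasDerivAt_of_lipschitzWith {E : Type*} [NormedAddCommGroup E]
    [NormedSpace ℝ E] [CompleteSpace E] {v : E → E} {K M : ℝ≥0} (hv : LipschitzWith K v)
    (hM : ∀ x, ‖v x‖ ≤ M) (x₀ : E) :
    ∃ y : ℝ → E, y 0 = x₀ ∧ ∀ t, HasDerivAt y (v (y t)) t := by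
  have hloc : ∀ n : ℕ, ∃ α : ℝ → E, α 0 = x₀ ∧
      ∀ t ∈ Ioo (-((n : ℝ) + 1)) (n + 1), HasDerivAt α (v (α t)) t := by
    intro n
    have hn : (0 : ℝ) < n + 1 := by positivity
    -- With speed at most M, a solution cannot leave the ball of radius M(n + 1) during time n + 1.
    have hpl : IsPicardLindelof (fun _ => v) (tmin := -((n : ℝ) + 1)) (tmax := n + 1)
        ⟨0, by linarith, hn.le⟩ x₀ (M * (n + 1)) 0 M K :=
      { lipschitzOnWith := fun _ _ => hv.lipschitzOnWith
        continuousOn := fun _ _ => continuousOn_const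
        norm_le := fun _ _ x _ => hM x
        mul_max_le := by simp }
    obtain ⟨α, hα0, hα⟩ := hpl.exists_eq_forall_mem_Icc_hasDerivWithinAt₀
    exact ⟨α, hα0, fun t ht => (hα t (Ioo_subset_Icc_self ht)).hasDerivAt (Icc_mem_nhds ht.1 ht.2)⟩
  choose α hα0 hα using hloc
  have hagree : ∀ m n : ℕ, m ≤ n → EqOn (α m) (α n) (Ioo (-((m : ℝ) + 1)) (m + 1)) := by
    intro m n hmn
    have hmn' : (m : ℝ) ≤ n := by exact_mod_cast hmn
    have hm : (0 : ℝ) < m + 1 := by positivity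
    refine ODE_solution_unique_of_mem_Ioo (v := fun _ => v) (s := fun _ => univ) (K := K)
      (t₀ := 0) (fun _ _ => hv.lipschitzOnWith) ⟨by linarith, hm⟩
      (fun t ht => ⟨hα m t ht, mem_univ _⟩)
      (fun t ht => ⟨hα n t ⟨by linarith [ht.1], by linarith [ht.2]⟩, mem_univ _⟩) ?_
    rw [hα0, hα0]
  refine ⟨fun t => α ⌊|t|⌋₊ t, by simp [hα0], fun t => ?_⟩
  -- The floor may jump at t; one step further gives a single solution that agrees with the glued
  -- curve on a whole neighbourhood of t.
  set N : ℕ := ⌊|t|⌋₊ + 1 with hN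
  have hlt : ∀ s : ℝ, s ∈ Ioo (-((⌊|s|⌋₊ : ℝ) + 1)) (⌊|s|⌋₊ + 1) := fun s =>
    abs_lt.1 (Nat.lt_floor_add_one |s|)
  have htN : |t| < N := by rw [hN]; exact_mod_cast Nat.lt_floor_add_one |t|
  have heq : (fun s => α ⌊|s|⌋₊ s) =ᶠ[𝓝 t] α N := by
    filter_upwards [(isOpen_lt continuous_abs continuous_const).mem_nhds htN] with s hs
    exact hagree _ N ((Nat.floor_lt (abs_nonneg s)).2 hs).le (hlt s)
  have htmem : t ∈ Ioo (-((N : ℝ) + 1)) (N + 1) := abs_lt.1 (htN.trans (lt_add_one _))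
  have := (hα N t htmem).congr_of_eventuallyEq heq
  rwa [← heq.eq_of_nhds] at this

namespace Toda

namespace Coeff

theorem lipschitzWith_clamp (ρ : ℝ) : LipschitzWith 1 fun t : ℝ => max (-ρ) (min ρ t) :=
  (LipschitzWith.id.const_min ρ).const_max (-ρ)

/-- Truncation of all coefficients to `[-ρ, ρ]`. -/
def clamp (ρ : ℝ) (x : Coeff) : Coeff :=
  (x.1.comp _ (lipschitzWith_clamp ρ), x.2.comp _ (lipschitzWith_clamp ρ))

theorem lipschitzWith_clamp_coeff (ρ : ℝ) : LipschitzWith 1 (clamp ρ) :=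
  ((BoundedContinuousFunction.lipschitz_comp (lipschitzWith_clamp ρ)).comp
    LipschitzWith.prod_fst).prodMk
    ((BoundedContinuousFunction.lipschitz_comp (lipschitzWith_clamp ρ)).comp
    LipschitzWith.prod_snd) |>.weaken (by simp)

theorem norm_clamp_le {ρ : ℝ} (hρ : 0 ≤ ρ) (x : Coeff) : ‖clamp ρ x‖ ≤ ρ := by
  have h : ∀ t : ℝ, |max (-ρ) (min ρ t)| ≤ ρ := fun t =>
    abs_le.2 ⟨le_max_left _ _, max_le (by linarith) (min_le_left _ _)⟩
  exact norm_le_of_forall hρ (fun n => h (x.1 n)) (fun n => h (x.2 n))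

theorem clamp_eq_self {ρ : ℝ} {x : Coeff} (hx : ‖x‖ ≤ ρ) : clamp ρ x = x := by
  have h : ∀ t : ℝ, |t| ≤ ρ → max (-ρ) (min ρ t) = t := fun t ht => by
    rw [min_eq_right (abs_le.1 ht).2, max_eq_right (abs_le.1 ht).1]
  ext n
  · exact h _ ((x.abs_fst_le n).trans hx)
  · exact h _ ((x.abs_snd_le n).trans hx)

/-- Global existence for the Lax equation on the space of coefficients. -/
theorem exists_hasDerivAt_field {f : ℝ → ℝ} (hf : ContDiff ℝ 2 f) (x₀ : Coeff) :
    ∃ y : ℝ → Coeff, y 0 = x₀ ∧ ∀ t, HasDerivAt y (field f (y t)) t := by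
  -- Clamping makes the field globally bounded and Lipschitz and changes nothing where ‖op x‖ < ρ.
  -- The a priori bound keeps the norm at most ‖op x₀‖ < ρ, so the solution of the clamped equation
  -- solves the original one.
  set ρ : ℝ := ‖op x₀‖ + 1 with hρ
  have hρ0 : 0 ≤ ρ := by positivity
  have hop : ∀ x, ‖op (clamp ρ x)‖ ≤ 3 * ρ := fun x =>
    (norm_op_le _).trans (by gcongr; exact norm_clamp_le hρ0 x)
  obtain ⟨L, hL⟩ := exists_norm_field_sub_le hf (3 * ρ)
  obtain ⟨M, hM⟩ := exists_norm_field_le hf.continuous (3 * ρ)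
  have hlip : LipschitzWith L fun x => field f (clamp ρ x) := by
    refine LipschitzWith.of_dist_le_mul fun x y => ?_
    rw [dist_eq_norm]
    refine (hL _ _ (hop x) (hop y)).trans ?_
    gcongr
    rw [← dist_eq_norm]
    simpa using (lipschitzWith_clamp_coeff ρ).dist_le_mul x y
  obtain ⟨y, hy0, hy⟩ := exists_forall_hasDerivAt_of_lipschitzWith hlip (fun x => hM _ (hop x)) x₀
  have hclamp : ∀ x, ‖op x‖ < ρ → field f (clamp ρ x) = field f x := fun x hx => by
    rw [clamp_eq_self (x.norm_le_norm_op.trans hx.le)]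
  refine ⟨y, hy0, fun t => ?_⟩
  have hle : ‖op (y t)‖ ≤ ‖op x₀‖ := norm_op_le_of_hasDerivAt hf.continuous (lt_add_one _) hclamp
    hy (by rw [hy0]) t
  rw [← hclamp _ (hle.trans_lt (lt_add_one _))]
  exact hy t

theorem norm_op_le_initial {f : ℝ → ℝ} (hf : Continuous f) {y : ℝ → Coeff}
    (hy : ∀ t, HasDerivAt y (field f (y t)) t) (t : ℝ) : ‖op (y t)‖ ≤ ‖op (y 0)‖ :=
  norm_op_le_of_hasDerivAt hf (v := field f) (lt_add_one _) (fun _ _ => rfl) hy le_rfl t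

/-- The field is Lipschitz only on bounded sets, but the a priori bound keeps both solutions in the
one set {‖op x‖ ≤ ‖op (y 0)‖}. -/
theorem unique_hasDerivAt_field {f : ℝ → ℝ} (hf : ContDiff ℝ 2 f) {y z : ℝ → Coeff}
    (hy : ∀ t, HasDerivAt y (field f (y t)) t) (hz : ∀ t, HasDerivAt z (field f (z t)) t)
    (h0 : y 0 = z 0) : y = z := by
  obtain ⟨L, hL⟩ := exists_norm_field_sub_le hf ‖op (y 0)‖
  refine ODE_solution_unique_univ (v := fun _ => field f) (K := L) (t₀ := 0)
    (s := fun _ => {x | ‖op x‖ ≤ ‖op (y 0)‖}) (fun _ => ?_)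
    (fun t => ⟨hy t, norm_op_le_initial hf.continuous hy t⟩)
    (fun t => ⟨hz t, h0 ▸ norm_op_le_initial hf.continuous hz t⟩) h0
  refine LipschitzOnWith.of_dist_le_mul fun x hx y hy => ?_
  rw [dist_eq_norm, dist_eq_norm]
  exact hL x y hx hy

/-- The Lax equation preserves the positivity of the off-diagonal coefficients. -/
theorem fst_pos_of_hasDerivAt_field {f : ℝ → ℝ} (hf : Continuous f) {y : ℝ → Coeff}
    (hy : ∀ t, HasDerivAt y (field f (y t)) t) (h0 : ∀ n, 0 < (y 0).1 n) (t : ℝ) (n : ℤ) :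
    0 < (y t).1 n := by
  obtain ⟨M, hM0, hM⟩ := exists_norm_cfc_le (Hil →L[ℂ] Hil) hf ‖op (y 0)‖
  set g : ℝ → ℝ := fun t => (entry (funCalc f (op (y t))) (n + 1) (n + 1)).re
    - (entry (funCalc f (op (y t))) n n).re with hg
  have hgM : ∀ t, ‖g t‖ ≤ M + M := fun t => by
    have h : ‖funCalc f (op (y t))‖ ≤ M :=
      hM _ (y t).isSelfAdjoint_op (norm_op_le_initial hf hy t)
    exact (norm_sub_le _ _).trans (add_le_add
      ((Complex.abs_re_le_norm _).trans ((norm_entry_le _ _ _).trans h))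
      ((Complex.abs_re_le_norm _).trans ((norm_entry_le _ _ _).trans h)))
  let φ : Coeff →L[ℝ] ℝ :=
    (BoundedContinuousFunction.evalCLM ℝ n).comp (ContinuousLinearMap.fst ℝ _ _)
  have hφ : ∀ x : Coeff, φ x = x.1 n := fun x => rfl
  -- Each off-diagonal coefficient solves the scalar linear equation u' = g u with g bounded. By
  -- uniqueness a zero at one time would make it vanish identically, so by continuity it keeps its
  -- sign.
  have hu : ∀ t, HasDerivAt (fun t => (y t).1 n) ((y t).1 n * g t) t := fun t =>
    φ.hasFDerivAt.comp_hasDerivAt t (hy t)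
  have hlip : ∀ t, LipschitzOnWith (M + M).toNNReal (fun u : ℝ => u * g t) univ := fun t => by
    refine (LipschitzWith.of_dist_le_mul fun u w => ?_).lipschitzOnWith
    rw [dist_eq_norm, dist_eq_norm, ← sub_mul, norm_mul, mul_comm,
      Real.coe_toNNReal _ (by positivity)]
    gcongr
    exact hgM t
  have hne : ∀ t, (y t).1 n ≠ 0 := by
    intro t ht
    have := ODE_solution_unique_univ (v := fun t (u : ℝ) => u * g t) (s := fun _ => univ)
      (f := fun t => (y t).1 n) (g := fun _ => 0) (t₀ := t) hlip (fun t => ⟨hu t, mem_univ _⟩)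
      (fun t => ⟨by simpa using hasDerivAt_const t (0 : ℝ), mem_univ _⟩) ht
    exact (h0 n).ne' (congrFun this 0)
  by_contra hneg
  have hcont : Continuous fun t => (y t).1 n :=
    continuous_iff_continuousAt.2 fun t => (hu t).continuousAt
  obtain ⟨s, hs⟩ := mem_range_of_exists_le_of_exists_ge hcont ⟨t, not_lt.1 hneg⟩ ⟨0, (h0 n).le⟩
  exact hne s hs

end Coeff

/-! ### Return to Jacobi matrices and proof of the theorem. -/

/-- Solutions of the Lax equation in terms of the coefficients. -/
theorem isLaxSolution_iff {f : ℝ → ℝ} (hf : Continuous f) (J : Jacobi) (γ : ℝ → Jacobi) :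
    IsLaxSolution f J γ ↔ (γ 0).coeff = J.coeff ∧
      ∀ t, HasDerivAt (fun s => (γ s).coeff) (Coeff.field f (γ t).coeff) t := by
  refine and_congr Jacobi.coeff_injective.eq_iff.symm (forall_congr' fun t => ?_)
  rw [laxField_eq hf]
  constructor
  · intro h
    have := Coeff.ofOp.hasFDerivAt.comp_hasDerivAt t h
    rwa [Coeff.ofOp_op] at this
  · intro h
    have := Coeff.op.hasFDerivAt.comp_hasDerivAt t h
    simpa only [Function.comp_def, Jacobi.op_coeff] using this

theorem existsUnique_isLaxSolution {f : ℝ → ℝ} (hf : ContDiff ℝ 2 f) (J : Jacobi) :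
    ∃! γ : ℝ → Jacobi, IsLaxSolution f J γ := by
  obtain ⟨y, hy0, hy⟩ := Coeff.exists_hasDerivAt_field hf J.coeff
  have hpos := Coeff.fst_pos_of_hasDerivAt_field hf.continuous hy
    (fun n => by rw [hy0, J.coeff_fst]; exact J.a_pos n)
  choose γ hγ using fun t => (y t).exists_jacobi (hpos t)
  refine ⟨γ, ?_, fun γ' h' => ?_⟩
  · refine (isLaxSolution_iff hf.continuous J γ).2 ?_
    simp only [hγ]
    exact ⟨hy0, hy⟩
  · have h := (isLaxSolution_iff hf.continuous J γ').1 h'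
    have := Coeff.unique_hasDerivAt_field hf h.2 hy (h.1.trans hy0.symm)
    funext t
    exact Jacobi.coeff_injective ((congrFun this t).trans (hγ t).symm)

/-- The map `J ↦ f · J` in terms of the coefficients. -/
theorem exists_curve_act {f : ℝ → ℝ} (hf : ContDiff ℝ 2 f) (J : Jacobi) :
    ∃ γ : ℝ → Jacobi, γ 0 = J ∧ γ 1 = act f J ∧
      (∀ t, HasDerivAt (fun s => (γ s).coeff) (Coeff.field f (γ t).coeff) t) ∧
      ∀ t, ‖(γ t).op‖ ≤ ‖J.op‖ := by
  have hex := (existsUnique_isLaxSolution hf J).exists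
  have hs := hex.choose_spec
  have hd := (isLaxSolution_iff hf.continuous J _).1 hs
  refine ⟨hex.choose, hs.1, by rw [act, dif_pos hex], hd.2, fun t => ?_⟩
  have := Coeff.norm_op_le_initial hf.continuous hd.2 t
  rwa [Jacobi.op_coeff, Jacobi.op_coeff, hs.1] at this

theorem supNorm_laxField_sub {f : ℝ → ℝ} (hf : Continuous f) (J J' : Jacobi) :
    supNorm (laxField f J - laxField f J')
      = ‖Coeff.field f J.coeff - Coeff.field f J'.coeff‖ := by
  rw [laxField_eq hf, laxField_eq hf, ← map_sub, Coeff.supNorm_op]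

theorem supNorm_op_sub (J J' : Jacobi) : supNorm (J.op - J'.op) = ‖J.coeff - J'.coeff‖ := by
  rw [← J.op_coeff, ← J'.op_coeff, ← map_sub, Coeff.supNorm_op]

theorem exists_isLaxLipschitzConst {f : ℝ → ℝ} (hf : ContDiff ℝ 2 f) (R : ℝ) :
    ∃ L : ℝ, 0 ≤ L ∧ IsLaxLipschitzConst f R L := by
  obtain ⟨L, hL⟩ := Coeff.exists_norm_field_sub_le hf R
  refine ⟨L, L.2, fun J J' hJ hJ' => ?_⟩
  rw [supNorm_laxField_sub hf.continuous, supNorm_op_sub]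
  exact hL _ _ (by rwa [J.op_coeff]) (by rwa [J'.op_coeff])

theorem supNorm_act_sub_le {f : ℝ → ℝ} (hf : ContDiff ℝ 2 f) {R L : ℝ}
    (hL : IsLaxLipschitzConst f R L) {J J' : Jacobi} (hJ : ‖J.op‖ ≤ R) (hJ' : ‖J'.op‖ ≤ R) :
    supNorm ((act f J).op - (act f J').op) ≤ supNorm (J.op - J'.op) * Real.exp L := by
  -- L is not assumed nonnegative; two distinct Jacobi matrices in the ball force L ≥ 0, which
  -- Grönwall's inequality needs.
  rcases eq_or_ne J J' with rfl | hne
  · rw [supNorm_op_sub, supNorm_op_sub, sub_self, sub_self, norm_zero, zero_mul]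
  have hpos : 0 < ‖J.coeff - J'.coeff‖ := norm_pos_iff.2
    (sub_ne_zero.2 (Jacobi.coeff_injective.ne hne))
  have hL0 : 0 ≤ L := by
    have := hL J J' hJ hJ'
    rw [supNorm_laxField_sub hf.continuous, supNorm_op_sub] at this
    exact nonneg_of_mul_nonneg_left ((norm_nonneg _).trans this) hpos
  obtain ⟨γ, h0, h1, hd, hn⟩ := exists_curve_act hf J
  obtain ⟨γ', h0', h1', hd', hn'⟩ := exists_curve_act hf J'
  -- L is a Lipschitz constant on Jacobi matrices only, so the set is the image of the ball of
  -- `Jacobi`, not a ball of `Coeff`. Both trajectories stay in it by the a priori bound.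
  have hlip : LipschitzOnWith L.toNNReal (Coeff.field f) (Jacobi.coeff '' {J | ‖J.op‖ ≤ R}) := by
    refine LipschitzOnWith.of_dist_le_mul ?_
    rintro _ ⟨J₁, hJ₁, rfl⟩ _ ⟨J₂, hJ₂, rfl⟩
    have := hL J₁ J₂ hJ₁ hJ₂
    rwa [supNorm_laxField_sub hf.continuous, supNorm_op_sub, ← dist_eq_norm, ← dist_eq_norm,
      ← Real.coe_toNNReal L hL0] at this
  have := dist_le_of_trajectories_ODE_of_mem (v := fun _ => Coeff.field f)
    (s := fun _ => Jacobi.coeff '' {J | ‖J.op‖ ≤ R}) (K := L.toNNReal) (a := 0) (b := 1)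
    (δ := ‖J.coeff - J'.coeff‖) (fun _ _ => hlip)
    (fun t _ => (hd t).continuousAt.continuousWithinAt) (fun t _ => (hd t).hasDerivWithinAt)
    (fun t _ => ⟨γ t, (hn t).trans hJ, rfl⟩)
    (fun t _ => (hd' t).continuousAt.continuousWithinAt) (fun t _ => (hd' t).hasDerivWithinAt)
    (fun t _ => ⟨γ' t, (hn' t).trans hJ', rfl⟩)
    (by rw [h0, h0', dist_eq_norm]) 1 (right_mem_Icc.2 zero_le_one)
  rw [h1, h1', dist_eq_norm, sub_zero, mul_one, Real.coe_toNNReal L hL0] at this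
  rwa [supNorm_op_sub, supNorm_op_sub]

theorem continuous_act {f : ℝ → ℝ} (hf : ContDiff ℝ 2 f) : Continuous (act f) := by
  have hop : Continuous Jacobi.op := continuous_induced_dom
  rw [continuous_induced_rng, continuous_iff_continuousAt]
  intro J
  -- The radius ‖J‖ + 1 covers a neighbourhood of J, so one constant L serves for all nearby J'.
  -- Equivalence of the two norms then gives continuity.
  obtain ⟨L, hL0, hL⟩ := exists_isLaxLipschitzConst hf (‖J.op‖ + 1)
  have hle : ∀ᶠ J' in 𝓝 J, ‖(act f J').op - (act f J).op‖
      ≤ 3 * (‖J'.op - J.op‖ * Real.exp L) := by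
    have hnhds : ∀ᶠ J' in 𝓝 J, ‖Jacobi.op J'‖ < ‖J.op‖ + 1 :=
      hop.norm.continuousAt.eventually_lt continuousAt_const (lt_add_one _)
    filter_upwards [hnhds] with J' hJ'
    have h1 := supNorm_act_sub_le hf hL hJ'.le (lt_add_one _).le
    rw [supNorm_op_sub, supNorm_op_sub] at h1
    have h2 : ‖J'.coeff - J.coeff‖ ≤ ‖J'.op - J.op‖ := by
      rw [← J.op_coeff, ← J'.op_coeff, ← map_sub]
      exact Coeff.norm_le_norm_op _
    rw [← (act f J').op_coeff, ← (act f J).op_coeff, ← map_sub]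
    refine (Coeff.norm_op_le _).trans ?_
    gcongr
    exact h1.trans (by gcongr)
  rw [ContinuousAt, tendsto_iff_norm_sub_tendsto_zero]
  refine squeeze_zero' (Eventually.of_forall fun _ => norm_nonneg _) hle ?_
  have : Continuous fun J' : Jacobi => 3 * (‖J'.op - J.op‖ * Real.exp L) := by fun_prop
  simpa using this.tendsto J

end Toda

end

theorem theorem2p3 (f : ℝ → ℝ) (hf : ContDiff ℝ 2 f) :
    (∀ J : Toda.Jacobi, ∃! γ : ℝ → Toda.Jacobi, Toda.IsLaxSolution f J γ) ∧
    Continuous (Toda.act f) ∧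
    (∀ R : ℝ, ∃ L : ℝ, 0 ≤ L ∧ Toda.IsLaxLipschitzConst f R L) ∧
    ∀ R L : ℝ, Toda.IsLaxLipschitzConst f R L →
      ∀ J J' : Toda.Jacobi, ‖J.op‖ ≤ R → ‖J'.op‖ ≤ R →
        Toda.supNorm ((Toda.act f J).op - (Toda.act f J').op)
          ≤ Toda.supNorm (J.op - J'.op) * Real.exp L :=
  ⟨Toda.existsUnique_isLaxSolution hf, Toda.continuous_act hf, Toda.exists_isLaxLipschitzConst hf,
    fun _ _ hL _ _ hJ hJ' => Toda.supNorm_act_sub_le hf hL hJ hJ'⟩
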